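/- Let $$\mathrm{SU}(1,1)=\left\{g=\begin{pmatrix}\alpha&\beta\\ \bar\beta&\bar\alpha\end{pmatrix}:\ \alpha,\beta\in\mathbb{C},\ |\alpha|^2-|\beta|^2=1\right\},$$ and parametrize it by $$g(\tau,\varphi,\psi)=\begin{pmatrix}e^{i\varphi/2}&0\\0&e^{-i\varphi/2}\end{pmatrix}\begin{pmatrix}\cosh\frac{\tau}{2}&\sinh\frac{\tau}{2}\\ \sinh\frac{\tau}{2}&\cosh\frac{\tau}{2}\end{pmatrix}\begin{pmatrix}e^{i\psi/2}&0\\0&e^{-i\psi/2}\end{pmatrix},\qquad \tau\ge 0,\ 0\le\varphi<2\pi,\ -2\pi\le\psi<2\pi .$$ Let $\mathrm{d}_{\mathrm{Haar}}(g)=\frac{1}{8\pi^2}\sinh\tau\,\mathrm{d}\tau\,\mathrm{d}\varphi\,\mathrm{d}\psi$; this is a Haar measure on $\mathrm{SU}(1,1)$. For $\eta$ with $2\eta\in\mathbb{N}$ and $2\eta>1$, the holomorphic discrete series representation $U^\eta$ acts on holomorphic functions on the unit disk $\mathcal{D}=\{z\in\mathbb{C}:|z|<1\}$ by $$(U^\eta(g)f)(z)=(-\bar\beta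 z+\alpha)^{-2\eta}\,f\!\left(\frac{\bar\alpha z-\beta}{-\bar\beta z+\alpha}\right).$$ Let $$\langle f_1|f_2\rangle_\eta=\frac{2\eta-1}{\pi}\int_{\mathcal{D}}\overline{f_1(z)}\,f_2(z)\,(1-|z|^2)^{2\eta-2}\,\mathrm{d}x\,\mathrm{d}y\qquad(z=x+iy),$$ and, for $n\in\mathbb{N}=\{0,1,2,\dots\}$, let $e^\eta_n(z)=\sqrt{(2\eta)_n/n!}\;z^n$ with $(2\eta)_n=\Gamma(2\eta+n)/\Gamma(2\eta)$; these functions form the standard orthonormal basis of the space of holomorphic functions on $\mathcal{D}$ that are square-integrable for this scalar product. Define the matrix elements $$U^\eta_{nn'}(g)=\langle e^\eta_n\,|\,U^\eta(g)\,e^\eta_{n'}\rangle_\eta .$$ Then for all $\eta_1,\eta_2$ with $2\eta_i\in\mathbb{N}$ and $2\eta_i>1$ $(i=1,2)$, and all $m,m',n,n'\in\mathbb{N}$, the function $U^{\eta_1}_{mm'}\,\overline{U^{\eta_2}_{nn'}}$ is integrable on $\mathrm{SU}(1,1)$ with respect to $\mathrm{d}_{\mathrm{Haar}}$ and $$\int_{\mathrm{SU}(1,1)}U^{\eta_1}_{mm'}(g)\,\overline{U^{\eta_2}_{nn'}(g)}\,\mathrm{d}_{\mathrm{Haar}}(g)=d_{\eta_1}\,\delta_{\eta_1\eta_2}\,\delta_{mn}\,\delta_{m'n'},\qquad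 d_\eta=\frac{2}{2\eta-1}.$$ -/

import Mathlib

open scoped ComplexConjugate

/-- The group `SU(1,1)`: the matrices `!![α, β; conj β, conj α]` with complex entries and
determinant `|α|² - |β|² = 1`, as a subgroup of `SL(2, ℂ)` (with the subspace topology). -/
def SU11 : Subgroup (Matrix.SpecialLinearGroup (Fin 2) ℂ) where
  carrier := {g | g 1 0 = conj (g 0 1) ∧ g 1 1 = conj (g 0 0)}
  one_mem' := by simp
  mul_mem' := by
    rintro a b ⟨ha, ha'⟩ ⟨hb, hb'⟩
    simp only [Set.mem_ofPred_eq, Matrix.SpecialLinearGroup.coe_mul, Matrix.mul_apply,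
      Fin.sum_univ_two, ha, ha', hb, hb', map_add, map_mul, Complex.conj_conj]
    constructor <;> ring
  inv_mem' := by
    rintro a ⟨ha, ha'⟩
    rw [Matrix.SpecialLinearGroup.SL2_inv_expl]
    constructor <;> simp [ha, ha']

namespace SU11

/-- `SU(1,1)` carries its Borel σ-algebra. -/
noncomputable instance instMeasurableSpace : MeasurableSpace SU11 := borel SU11

instance instBorelSpace : BorelSpace SU11 := ⟨rfl⟩

/-- The upper left entry `α` of `g = !![α, β; conj β, conj α]`. -/
def alpha (g : SU11) : ℂ := g.1 0 0

/-- The upper right entry `β` of `g = !![α, β; conj β, conj α]`. -/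
def beta (g : SU11) : ℂ := g.1 0 1

/-- The element `!![α, β; conj β, conj α]` of `SU(1,1)`, for `α conj α - β conj β = 1`. -/
noncomputable def mk (α β : ℂ) (h : α * conj α - β * conj β = 1) : SU11 :=
  ⟨⟨!![α, β; conj β, conj α], by rw [Matrix.det_fin_two_of]; exact h⟩, by constructor <;> simp⟩

/-- The element `diag (e^{iθ/2}, e^{-iθ/2})`. -/
noncomputable def rotation (θ : ℝ) : SU11 :=
  mk (Complex.exp (Complex.I * ((θ / 2 : ℝ) : ℂ))) 0 (by
    rw [← Complex.exp_conj, ← Complex.exp_add]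
    rw [map_mul, Complex.conj_I, Complex.conj_ofReal]
    simp)

/-- The element `!![cosh (τ/2), sinh (τ/2); sinh (τ/2), cosh (τ/2)]`. -/
noncomputable def boost (τ : ℝ) : SU11 :=
  mk (Real.cosh (τ / 2) : ℂ) (Real.sinh (τ / 2) : ℂ) (by
    rw [Complex.conj_ofReal, Complex.conj_ofReal, ← Complex.ofReal_mul, ← Complex.ofReal_mul,
      ← Complex.ofReal_sub, ← sq, ← sq, Real.cosh_sq_sub_sinh_sq, Complex.ofReal_one])

/-- The parametrization of `SU(1,1)` by the coordinates `(τ, φ, ψ)`. -/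
noncomputable def param (p : ℝ × ℝ × ℝ) : SU11 :=
  rotation p.2.1 * boost p.1 * rotation p.2.2

/-- The measure `(1 / (8 π²)) sinh τ dτ dφ dψ` on `SU(1,1)`, where
`0 ≤ τ < ∞`, `0 ≤ φ < 2π` and `-2π ≤ ψ < 2π`. -/
noncomputable def haar : MeasureTheory.Measure SU11 :=
  MeasureTheory.Measure.map param
    (((MeasureTheory.volume : MeasureTheory.Measure (ℝ × ℝ × ℝ)).restrict
        (Set.Ici 0 ×ˢ Set.Ico 0 (2 * Real.pi) ×ˢ Set.Ico (-(2 * Real.pi)) (2 * Real.pi))).withDensity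
      (fun p => ENNReal.ofReal (1 / (8 * Real.pi ^ 2) * Real.sinh p.1)))

/-- The scalar product of the Fock-Bargmann space of holomorphic functions on the unit disk,
`⟨f₁|f₂⟩ = ((2η - 1) / π) ∫_{|z| < 1} conj (f₁ z) f₂ z (1 - |z|²)^(2η - 2) dx dy`, that is,
`((2η - 1) / (2π)) ∫ … d²z` with `d²z = i dz ∧ d(conj z) = 2 dx dy`. With this normalization
of `d²z` the functions `basisFun η n` below are orthonormal. -/
noncomputable def fbInner (η : ℝ) (f₁ f₂ : ℂ → ℂ) : ℂ :=
  ((2 * η - 1) / Real.pi : ℝ) *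
    ∫ z in Metric.ball (0 : ℂ) 1, conj (f₁ z) * f₂ z * (((1 - ‖z‖ ^ 2) ^ (2 * η - 2) : ℝ) : ℂ)

/-- The orthonormal basis `e_n(z) = √((2η)_n / n!) z^n`, with
`(2η)_n = Γ(2η + n) / Γ(2η)`. -/
noncomputable def basisFun (η : ℝ) (n : ℕ) (z : ℂ) : ℂ :=
  (Real.sqrt (Real.Gamma (2 * η + n) / Real.Gamma (2 * η) / (Nat.factorial n : ℝ)) : ℝ) * z ^ n

/-- The operator `U^η(g)` of the holomorphic discrete series,
`(U^η(g) f)(z) = (-conj β z + α)^(-2η) f ((conj α z - β) / (-conj β z + α))` for `|z| < 1`.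
It is used for `2η ∈ ℕ`, when the power is an integer power. -/
noncomputable def discreteSeries (η : ℝ) (g : SU11) (f : ℂ → ℂ) (z : ℂ) : ℂ :=
  (-conj (beta g) * z + alpha g) ^ (-(2 * η : ℂ)) *
    f ((conj (alpha g) * z - beta g) / (-conj (beta g) * z + alpha g))

/-- The matrix element `U^η_{n n'}(g) = ⟨e_n | U^η(g) | e_{n'}⟩`. -/
noncomputable def matrixElement (η : ℝ) (n n' : ℕ) (g : SU11) : ℂ :=
  fbInner η (basisFun η n) (discreteSeries η g (basisFun η n'))

/-- The (formal) dimension `d_η = 2 / (2η - 1)`. -/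
noncomputable def formalDim (η : ℝ) : ℝ := 2 / (2 * η - 1)

end SU11

/-! The Haar property and the orthogonality relations are independent.

Haar property: the first column `(α, conj β)` of `g` is a vector of `ℂ²` with `|x|² - |y|² = 1`, and
left multiplication acts on first columns by a linear map of determinant 1. Normalizing the vectors
of the cone `0 < |x|² - |y|² < 1` therefore carries Lebesgue measure to a left-invariant measure
`coneMeasure`; the bound by 1 keeps it finite on compact sets. Polar coordinates in both components
identify it with `sinh τ dτ dφ dψ` up to a constant (`haar_eq_smul_coneMeasure`).

Orthogonality: put `t = tanh (τ/2)` and `k = 2η`. By `matrixElement_param` the matrix element with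
indices `n, l` is `exp (-i(η+n)φ) exp (-i(η+l)ψ) cosh(τ/2)^(-k)` times, up to normalization, the
coefficient `p_n(t)` of `z^n` in `(z - t)^l (1 - t z)^(-(k+l))`. The angular integrals vanish unless
`η₁ + m = η₂ + n` and `η₁ + m' = η₂ + n'`. What remains is the pairing `⟨p, q⟩ = ∫₀¹ p q (1 - t²)^b
2t dt` with `b = η₁ + η₂ - 2`.

The `su(1,1)` operators `∂_z` and `z²∂_z + k z` give two ladder relations, of first order in `t`,
between `p_n` and `p_(n+1)`. Integrating a total derivative turns them into `(m+1)⟨p_(m+1), q_(n+1)⟩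
= (n+k₂)⟨p_m, q_n⟩` (`radialPairing_succ`). Exchanging `p` and `q` gives a second equation in the
same two unknowns. The determinant is a nonzero multiple of `(k₁ - k₂)(b + 1)`, so the pairing
vanishes when `k₁ ≠ k₂` (`radialPairing_eq_zero`). When `k₁ = k₂` the recurrence reduces the norm to
a Beta integral at `n = 0` (`radialPairing_self`). -/

namespace SU11

/-! ### Radial polynomials, their ladder relations and their weighted pairing. -/

section RadialPolynomials

open Polynomial

/-- Coefficientwise differentiation of power series over `ℝ[X]`. -/
noncomputable def coeffDerivative : Derivation ℝ (PowerSeries ℝ[X]) (PowerSeries ℝ[X]) :=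
  Derivation.mk'
    { toFun := fun f => PowerSeries.mk fun n => derivative (PowerSeries.coeff n f)
      map_add' := fun f g => by ext1 n; simp
      map_smul' := fun r f => by ext1 n; simp }
    (fun f g => by
      ext1 n
      simp only [LinearMap.coe_mk, AddHom.coe_mk, PowerSeries.coeff_mk, PowerSeries.coeff_mul,
        smul_eq_mul, map_add, derivative_sum, derivative_mul, Finset.sum_add_distrib]
      rw [add_comm]
      congr 1
      rw [Finset.Nat.sum_antidiagonal_swap (n := n)
        (f := fun p => PowerSeries.coeff p.1 g * derivative (PowerSeries.coeff p.2 f)) |>.symm]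
      exact Finset.sum_congr rfl fun p _ => by simp [mul_comm])

theorem coeff_coeffDerivative (f : PowerSeries ℝ[X]) (n : ℕ) :
    PowerSeries.coeff n (coeffDerivative f) = derivative (PowerSeries.coeff n f) := by
  simp [coeffDerivative]

theorem coeffDerivative_X : coeffDerivative (PowerSeries.X : PowerSeries ℝ[X]) = 0 := by
  ext1 n
  rw [coeff_coeffDerivative, PowerSeries.coeff_X]
  split_ifs <;> simp

theorem coeffDerivative_C (p : ℝ[X]) :
    coeffDerivative (PowerSeries.C p) = PowerSeries.C (derivative p) := by
  ext1 n
  rw [coeff_coeffDerivative, PowerSeries.coeff_C, PowerSeries.coeff_C]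
  split_ifs <;> simp

/-- The geometric series `∑ tⁿ zⁿ = (1 - t z)⁻¹`. -/
noncomputable def geomSeries : PowerSeries ℝ[X] := PowerSeries.mk fun n => (X : ℝ[X]) ^ n

theorem one_sub_mul_geomSeries :
    (1 - PowerSeries.C (X : ℝ[X]) * PowerSeries.X) * geomSeries = 1 := by
  ext1 n
  rw [sub_mul, one_mul, mul_assoc, map_sub, PowerSeries.coeff_C_mul]
  cases n with
  | zero => simp [geomSeries]
  | succ n => simp [geomSeries, PowerSeries.coeff_succ_X_mul, PowerSeries.coeff_one, pow_succ']

/-- The series `(z - t)^l (1 - t z)^(-(k + l))` in `z`. -/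
noncomputable def radialSeries (k l : ℕ) : PowerSeries ℝ[X] :=
  (PowerSeries.X - PowerSeries.C (X : ℝ[X])) ^ l * geomSeries ^ (k + l)

/-- The coefficient of `z^n` in `(z - t)^l (1 - t z)^(-(k + l))`, a polynomial in `t`. -/
noncomputable def radialPoly (k l n : ℕ) : ℝ[X] := PowerSeries.coeff n (radialSeries k l)

theorem coeffDerivative_geomSeries :
    coeffDerivative geomSeries = PowerSeries.X * geomSeries ^ 2 := by
  have h := congrArg coeffDerivative one_sub_mul_geomSeries
  rw [Derivation.leibniz, map_sub, Derivation.leibniz, coeffDerivative_C, coeffDerivative_X,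
    Derivation.map_one_eq_zero] at h
  simp only [smul_eq_mul, derivative_X, map_one] at h
  linear_combination geomSeries * h - coeffDerivative geomSeries * one_sub_mul_geomSeries

/-- The formal derivative of power series, as a derivation over `ℤ`. -/
noncomputable def seriesDerivative (R : Type*) [CommRing R] :
    Derivation ℤ (PowerSeries R) (PowerSeries R) :=
  (PowerSeries.derivative R).restrictScalars ℤ

theorem coeff_seriesDerivative {R : Type*} [CommRing R] (f : PowerSeries R) (n : ℕ) :
    PowerSeries.coeff n (seriesDerivative R f) = PowerSeries.coeff (n + 1) f * (n + 1) :=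
  PowerSeries.coeff_derivative f n

theorem seriesDerivative_C {R : Type*} [CommRing R] (r : R) :
    seriesDerivative R (PowerSeries.C r) = 0 :=
  PowerSeries.derivative_C

theorem seriesDerivative_X {R : Type*} [CommRing R] :
    seriesDerivative R PowerSeries.X = 1 :=
  PowerSeries.derivative_X

theorem seriesDerivative_geomSeries :
    seriesDerivative ℝ[X] geomSeries = PowerSeries.C (X : ℝ[X]) * geomSeries ^ 2 := by
  have h := congrArg (seriesDerivative ℝ[X]) one_sub_mul_geomSeries
  rw [Derivation.leibniz, map_sub, Derivation.leibniz, seriesDerivative_C,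
    seriesDerivative_X, Derivation.map_one_eq_zero] at h
  simp only [smul_eq_mul] at h
  linear_combination geomSeries * h -
    seriesDerivative ℝ[X] geomSeries * one_sub_mul_geomSeries

/-- This is the logarithmic derivative in `t`; the factor `z - t` clears the denominator that is not
invertible as a power series. -/
theorem coeffDerivative_radialSeries (k l : ℕ) :
    (PowerSeries.X - PowerSeries.C (X : ℝ[X])) * coeffDerivative (radialSeries k l) =
      (-(l : PowerSeries ℝ[X]) + ((k : PowerSeries ℝ[X]) + (l : PowerSeries ℝ[X])) *
        PowerSeries.X * (PowerSeries.X - PowerSeries.C (X : ℝ[X])) * geomSeries) *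
          radialSeries k l := by
  rw [radialSeries, Derivation.leibniz, Derivation.leibniz_pow, Derivation.leibniz_pow,
    coeffDerivative_geomSeries, map_sub, coeffDerivative_X, coeffDerivative_C]
  simp only [smul_eq_mul, nsmul_eq_mul, derivative_X, map_one]
  -- The power rule produces the truncated exponents `l - 1` and `k + l - 1`, hence the cases.
  rcases l with _ | l <;> rcases k with _ | k <;> simp <;> ring

theorem seriesDerivative_radialSeries (k l : ℕ) :
    (PowerSeries.X - PowerSeries.C (X : ℝ[X])) * seriesDerivative ℝ[X] (radialSeries k l) =
      ((l : PowerSeries ℝ[X]) + ((k : PowerSeries ℝ[X]) + (l : PowerSeries ℝ[X])) *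
        PowerSeries.C (X : ℝ[X]) * (PowerSeries.X - PowerSeries.C (X : ℝ[X])) * geomSeries) *
          radialSeries k l := by
  rw [radialSeries, Derivation.leibniz, Derivation.leibniz_pow, Derivation.leibniz_pow,
    seriesDerivative_geomSeries, map_sub, seriesDerivative_X, seriesDerivative_C]
  simp only [smul_eq_mul, nsmul_eq_mul]
  rcases l with _ | l <;> rcases k with _ | k <;> simp <;> ring

theorem X_sub_C_X_ne_zero : (PowerSeries.X - PowerSeries.C (X : ℝ[X])) ≠ 0 := by
  intro h
  have := congrArg (PowerSeries.coeff 1) h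
  simp at this

/-- The operator `∂_z` is traded for `∂_t` and the Euler operator `z∂_z`. The latter acts on the
coefficient of `z^n` as multiplication by `n`, so comparing coefficients leaves a first-order
relation in `t`. After multiplication by `z - t`, a nonzero element of a domain, both logarithmic
derivatives apply. -/
theorem lowering_radialSeries (k l : ℕ) :
    PowerSeries.C (2 * (X : ℝ[X])) * seriesDerivative ℝ[X] (radialSeries k l) =
      PowerSeries.C (-((X : ℝ[X]) * (1 - X ^ 2))) * coeffDerivative (radialSeries k l) +
        PowerSeries.C (1 + (X : ℝ[X]) ^ 2) *
          (PowerSeries.X * seriesDerivative ℝ[X] (radialSeries k l)) +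
        PowerSeries.C (2 * (k : ℝ[X]) * X ^ 2 - (1 - (X : ℝ[X]) ^ 2) * (l : ℝ[X])) *
          radialSeries k l := by
  apply mul_left_cancel₀ X_sub_C_X_ne_zero
  simp only [map_sub, map_add, map_mul, map_pow, map_one, map_neg, map_natCast, map_ofNat]
  have h₁ := coeffDerivative_radialSeries k l
  have h₂ := seriesDerivative_radialSeries k l
  have h₃ := one_sub_mul_geomSeries
  generalize radialSeries k l = F at *
  generalize PowerSeries.C (X : ℝ[X]) = t at *
  linear_combination (t * (1 - t ^ 2)) * h₁ + (2 * t - PowerSeries.X * (1 + t ^ 2)) * h₂ +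
    (2 * t ^ 2 * (PowerSeries.X - t) * F *
      ((k : PowerSeries ℝ[X]) + (l : PowerSeries ℝ[X]))) * h₃

/-- The companion relation for `z²∂_z + k z`; `∂_t` enters with the opposite sign, which is what
makes the two relations combine into a total derivative. -/
theorem raising_radialSeries (k l : ℕ) :
    PowerSeries.C (2 * (X : ℝ[X])) * (PowerSeries.X * (PowerSeries.X *
        seriesDerivative ℝ[X] (radialSeries k l))) +
      PowerSeries.C (2 * (X : ℝ[X]) * (k : ℝ[X])) * (PowerSeries.X * radialSeries k l) =
      PowerSeries.C ((X : ℝ[X]) * (1 - X ^ 2)) * coeffDerivative (radialSeries k l) +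
        PowerSeries.C (1 + (X : ℝ[X]) ^ 2) *
          (PowerSeries.X * seriesDerivative ℝ[X] (radialSeries k l)) -
        PowerSeries.C ((1 - (X : ℝ[X]) ^ 2) * (l : ℝ[X])) * radialSeries k l := by
  apply mul_left_cancel₀ X_sub_C_X_ne_zero
  simp only [map_sub, map_add, map_mul, map_pow, map_one, map_natCast, map_ofNat]
  have h₁ := coeffDerivative_radialSeries k l
  have h₂ := seriesDerivative_radialSeries k l
  have h₃ := one_sub_mul_geomSeries
  generalize radialSeries k l = F at *
  generalize PowerSeries.C (X : ℝ[X]) = t at *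
  linear_combination (-t * (1 - t ^ 2)) * h₁ +
    (2 * t * PowerSeries.X ^ 2 - PowerSeries.X * (1 + t ^ 2)) * h₂ -
    (2 * t * PowerSeries.X * (PowerSeries.X - t) * F *
      ((k : PowerSeries ℝ[X]) + (l : PowerSeries ℝ[X]))) * h₃

theorem coeff_X_mul_seriesDerivative {R : Type*} [CommRing R] (f : PowerSeries R) (n : ℕ) :
    PowerSeries.coeff n (PowerSeries.X * seriesDerivative R f) = n * PowerSeries.coeff n f := by
  cases n with
  | zero => simp
  | succ n =>
    rw [PowerSeries.coeff_succ_X_mul, coeff_seriesDerivative]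
    push_cast
    ring

theorem lowering_radialPoly (k l n : ℕ) :
    2 * (X : ℝ[X]) * ((n : ℝ[X]) + 1) * radialPoly k l (n + 1) =
      -((X : ℝ[X]) * (1 - X ^ 2) * derivative (radialPoly k l n)) +
        (2 * (k : ℝ[X]) * X ^ 2 + (1 + X ^ 2) * (n : ℝ[X]) - (1 - X ^ 2) * (l : ℝ[X])) *
          radialPoly k l n := by
  have h := congrArg (PowerSeries.coeff n) (lowering_radialSeries k l)
  simp only [LinearMap.map_add, PowerSeries.coeff_C_mul, coeff_X_mul_seriesDerivative,
    coeff_seriesDerivative, coeff_coeffDerivative] at h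
  simp only [radialPoly] at h ⊢
  linear_combination h

theorem raising_radialPoly (k l n : ℕ) :
    2 * (X : ℝ[X]) * ((n : ℝ[X]) + (k : ℝ[X])) * radialPoly k l n =
      X * (1 - X ^ 2) * derivative (radialPoly k l (n + 1)) +
        ((1 + X ^ 2) * ((n : ℝ[X]) + 1) - (1 - X ^ 2) * (l : ℝ[X])) *
          radialPoly k l (n + 1) := by
  have h := congrArg (PowerSeries.coeff (n + 1)) (raising_radialSeries k l)
  simp only [LinearMap.map_add, LinearMap.map_sub, PowerSeries.coeff_C_mul] at h
  simp only [coeff_X_mul_seriesDerivative, coeff_coeffDerivative] at h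
  rw [PowerSeries.coeff_succ_X_mul, coeff_X_mul_seriesDerivative, PowerSeries.coeff_succ_X_mul] at h
  simp only [radialPoly] at h ⊢
  push_cast at h
  linear_combination h

theorem radialPoly_zero (k l : ℕ) : radialPoly k l 0 = (-X) ^ l := by
  simp [radialPoly, radialSeries, geomSeries]

/-- The weighted integral `∫₀¹ p q (1 - t²)^b 2t dt`. -/
noncomputable def radialPairing (b : ℕ) (p q : ℝ[X]) : ℝ :=
  ∫ t in (0 : ℝ)..1, (2 * X * (1 - X ^ 2) ^ b * p * q).eval t

theorem radialPairing_comm (b : ℕ) (p q : ℝ[X]) : radialPairing b p q = radialPairing b q p := by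
  rw [radialPairing, radialPairing, mul_right_comm]

theorem intervalIntegral_eval_derivative (p : ℝ[X]) (a b : ℝ) :
    ∫ t in a..b, (derivative p).eval t = p.eval b - p.eval a :=
  intervalIntegral.integral_eq_sub_of_hasDerivAt (fun t _ => p.hasDerivAt t)
    ((derivative p).continuous.intervalIntegrable _ _)

/-- Discrete form of the adjointness of the ladder operators: lowering is applied to the first
factor and raising to the second, and their sum is the derivative of `t (1 - t²)^(b+1) p_m q_(n+1)`.
The three hypotheses cancel the terms without derivatives. -/
theorem radialPairing_succ {k₁ k₂ l₁ l₂ m n b : ℕ} (hk : k₁ + k₂ = 2 * b + 4)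
    (hl : k₁ + 2 * l₁ = k₂ + 2 * l₂) (hn : k₁ + 2 * m = k₂ + 2 * n) :
    (m + 1) * radialPairing b (radialPoly k₁ l₁ (m + 1)) (radialPoly k₂ l₂ (n + 1)) =
      (n + k₂) * radialPairing b (radialPoly k₁ l₁ m) (radialPoly k₂ l₂ n) := by
  have key : derivative (X * (1 - X ^ 2) ^ (b + 1) * radialPoly k₁ l₁ m *
        radialPoly k₂ l₂ (n + 1)) =
      C ((n : ℝ) + k₂) * (2 * X * (1 - X ^ 2) ^ b * radialPoly k₁ l₁ m * radialPoly k₂ l₂ n) -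
      C ((m : ℝ) + 1) * (2 * X * (1 - X ^ 2) ^ b * radialPoly k₁ l₁ (m + 1) *
        radialPoly k₂ l₂ (n + 1)) := by
    have h₁ := lowering_radialPoly k₁ l₁ m
    have h₂ := raising_radialPoly k₂ l₂ n
    have hk' : (k₁ : ℝ[X]) + k₂ = 2 * b + 4 := by exact_mod_cast hk
    have hl' : (k₁ : ℝ[X]) + 2 * l₁ = k₂ + 2 * l₂ := by exact_mod_cast hl
    have hn' : (k₁ : ℝ[X]) + 2 * m = k₂ + 2 * n := by exact_mod_cast hn
    simp only [derivative_mul, derivative_pow, derivative_sub, derivative_one, derivative_X,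
      map_add, map_natCast, map_one]
    simp only [Nat.add_sub_cancel, Nat.cast_add, Nat.cast_one, pow_succ]
    generalize radialPoly k₁ l₁ (m + 1) = p' at *
    generalize radialPoly k₁ l₁ m = p at *
    generalize radialPoly k₂ l₂ (n + 1) = q' at *
    generalize radialPoly k₂ l₂ n = q at *
    apply mul_left_cancel₀ (two_ne_zero : (2 : ℝ[X]) ≠ 0)
    linear_combination (2 * (1 - X ^ 2) ^ b * q') * h₁ - (2 * (1 - X ^ 2) ^ b * p) * h₂ +
      (1 - X ^ 2) ^ b * p * q' * (2 * X ^ 2 * hk' + (1 + X ^ 2) * hn' - (1 - X ^ 2) * hl')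
  have h := intervalIntegral_eval_derivative (X * (1 - X ^ 2) ^ (b + 1) * radialPoly k₁ l₁ m *
    radialPoly k₂ l₂ (n + 1)) 0 1
  rw [key] at h
  simp only [eval_sub, eval_C_mul] at h
  rw [intervalIntegral.integral_sub, intervalIntegral.integral_const_mul,
    intervalIntegral.integral_const_mul] at h
  · simp only [radialPairing]
    -- The primitive vanishes at 1 through `(1 - X²)^(b+1)` and at 0 through the factor `X`.
    have h0 : ((1 : ℝ[X]) - X ^ 2).eval 1 = 0 := by simp
    simp only [eval_mul, eval_pow, h0] at h ⊢
    simp at h ⊢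
    linarith
  · exact (Continuous.intervalIntegrable (by fun_prop) _ _)
  · exact (Continuous.intervalIntegrable (by fun_prop) _ _)

theorem radialPairing_eq_zero {k₁ k₂ l₁ l₂ m n b : ℕ} (hk : k₁ + k₂ = 2 * b + 4)
    (hl : k₁ + 2 * l₁ = k₂ + 2 * l₂) (hn : k₁ + 2 * m = k₂ + 2 * n) (hne : k₁ ≠ k₂) :
    radialPairing b (radialPoly k₁ l₁ m) (radialPoly k₂ l₂ n) = 0 := by
  have h₁ := radialPairing_succ hk hl hn
  have h₂ := radialPairing_succ (b := b) (by omega) hl.symm hn.symm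
  rw [radialPairing_comm, radialPairing_comm b (radialPoly k₂ l₂ n)] at h₂
  generalize radialPairing b (radialPoly k₁ l₁ m) (radialPoly k₂ l₂ n) = x at *
  generalize radialPairing b (radialPoly k₁ l₁ (m + 1)) (radialPoly k₂ l₂ (n + 1)) = y at *
  have hk' : (k₁ : ℝ) + k₂ = 2 * b + 4 := by exact_mod_cast hk
  have hn' : (k₁ : ℝ) + 2 * m = k₂ + 2 * n := by exact_mod_cast hn
  have hm' : (m : ℝ) = ((k₂ : ℝ) - k₁) / 2 + n := by linarith
  -- Eliminating `y` leaves `(m+1)(m+k₁) - (n+1)(n+k₂)` as the coefficient of `x`; by `hk` and `hn`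
  -- this is `(k₂ - k₁)(b + 1)/2`.
  have h : (((k₁ : ℝ) - k₂) * (b + 1)) * x = 0 := by
    have hb : (b : ℝ) = (k₁ + k₂ - 4) / 2 := by linarith
    rw [hm'] at h₁ h₂
    rw [hb]
    linear_combination -2 * ((n : ℝ) + 1) * h₁ + 2 * (((k₂ : ℝ) - k₁) / 2 + n + 1) * h₂
  rcases mul_eq_zero.1 h with h | h
  · rcases mul_eq_zero.1 h with h | h
    · exact absurd (by exact_mod_cast sub_eq_zero.1 h) hne
    · exact absurd h (by positivity)
  · exact h

/-- The Beta integral in `s = t²`; integration by parts trades a factor `1 - t²` for a factor `t²`,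
so the induction on `b` must leave `l` free. -/
theorem integral_pow_mul_one_sub_sq_pow (b l : ℕ) :
    ∫ t in (0 : ℝ)..1, 2 * t * (1 - t ^ 2) ^ b * t ^ (2 * l) =
      (l.factorial * b.factorial : ℝ) / (l + b + 1).factorial := by
  induction b generalizing l with
  | zero =>
    have : ∀ t : ℝ, 2 * t * (1 - t ^ 2) ^ 0 * t ^ (2 * l) = 2 * t ^ (2 * l + 1) := by
      intro t; ring
    simp only [this]
    rw [intervalIntegral.integral_const_mul, integral_pow, add_zero, Nat.factorial_succ]
    have := Nat.factorial_ne_zero l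
    push_cast
    field_simp
    simp
    ring
  | succ b ih =>
    have h := intervalIntegral_eval_derivative (X ^ (2 * (l + 1)) * (1 - X ^ 2) ^ (b + 1)) 0 1
    have key : ∀ t : ℝ, (derivative (X ^ (2 * (l + 1)) * (1 - X ^ 2) ^ (b + 1) : ℝ[X])).eval t =
        ((l : ℝ) + 1) * (2 * t * (1 - t ^ 2) ^ (b + 1) * t ^ (2 * l)) -
        ((b : ℝ) + 1) * (2 * t * (1 - t ^ 2) ^ b * t ^ (2 * (l + 1))) := by
      intro t
      rw [show 2 * (l + 1) = 2 * l + 1 + 1 by ring]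
      simp only [derivative_mul, derivative_pow, derivative_sub, derivative_one, derivative_X,
        Nat.add_sub_cancel]
      simp
      ring
    simp only [key] at h
    rw [intervalIntegral.integral_sub (Continuous.intervalIntegrable (by fun_prop) _ _)
      (Continuous.intervalIntegrable (by fun_prop) _ _), intervalIntegral.integral_const_mul,
      intervalIntegral.integral_const_mul, ih (l + 1)] at h
    simp at h
    have hl : (l : ℝ) + 1 ≠ 0 := by positivity
    apply mul_left_cancel₀ hl
    rw [sub_eq_zero.1 h, show l + 1 + b + 1 = l + (b + 1) + 1 by ring, Nat.factorial_succ b,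
      Nat.factorial_succ l]
    push_cast
    ring

/-- For `k₁ = k₂ = b + 2` the recurrence multiplies the norm by `(n + b + 2)/(n + 1)` at each step,
starting from the Beta integral of `t^(2l)`. -/
theorem radialPairing_self (b l n : ℕ) :
    radialPairing b (radialPoly (b + 2) l n) (radialPoly (b + 2) l n) =
      ((b + 1 + n).factorial / ((b + 1).factorial * n.factorial) : ℝ) *
        (l.factorial * b.factorial / (l + b + 1).factorial) := by
  induction n with
  | zero =>
    rw [← integral_pow_mul_one_sub_sq_pow]
    simp only [radialPairing, radialPoly_zero]
    have : ((b + 1 + 0).factorial / ((b + 1).factorial * (0 : ℕ).factorial) : ℝ) = 1 := by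
      rw [add_zero, Nat.factorial_zero, Nat.cast_one, mul_one,
        div_self (by exact_mod_cast Nat.factorial_ne_zero (b + 1))]
    rw [this, one_mul]
    congr 1
    ext t
    simp only [eval_mul, eval_pow, eval_neg, eval_X, eval_sub, eval_one, eval_ofNat]
    rw [mul_assoc, ← mul_pow, neg_mul_neg, ← sq, ← pow_mul]
  | succ n ih =>
    have h := radialPairing_succ (k₁ := b + 2) (k₂ := b + 2) (l₁ := l) (l₂ := l) (m := n) (n := n)
      (b := b) (by ring) rfl rfl
    have hn : (n : ℝ) + 1 ≠ 0 := by positivity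
    apply mul_left_cancel₀ hn
    rw [h, ih, ← add_assoc, Nat.factorial_succ (b + 1 + n), Nat.factorial_succ n]
    have := Nat.factorial_ne_zero n
    have := Nat.factorial_ne_zero (b + 1)
    have := Nat.factorial_ne_zero (l + b + 1)
    push_cast
    field_simp
    ring

end RadialPolynomials
end SU11

namespace SU11

/-! ### A Haar measure from Lebesgue measure on a cone in `ℂ²`. -/

section Cone

open MeasureTheory

theorem ext_alpha_beta {g h : SU11} (hα : alpha g = alpha h) (hβ : beta g = beta h) : g = h := by
  apply Subtype.ext
  apply Subtype.ext
  obtain ⟨hg₁, hg₂⟩ := g.2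
  obtain ⟨hh₁, hh₂⟩ := h.2
  ext i j
  fin_cases i <;> fin_cases j
  · exact hα
  · exact hβ
  · exact hg₁.trans ((congrArg conj hβ).trans hh₁.symm)
  · exact hg₂.trans ((congrArg conj hα).trans hh₂.symm)

@[simp] theorem alpha_mk (α β : ℂ) (h) : alpha (mk α β h) = α := rfl

@[simp] theorem beta_mk (α β : ℂ) (h) : beta (mk α β h) = β := rfl

theorem alpha_mul (g h : SU11) :
    alpha (g * h) = alpha g * alpha h + beta g * conj (beta h) := by
  have : h.1 1 0 = conj (h.1 0 1) := h.2.1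
  simp only [alpha, beta, Subgroup.coe_mul, Matrix.SpecialLinearGroup.coe_mul, Matrix.mul_apply,
    Fin.sum_univ_two]
  rw [this]

theorem beta_mul (g h : SU11) :
    beta (g * h) = alpha g * beta h + beta g * conj (alpha h) := by
  have : h.1 1 1 = conj (h.1 0 0) := h.2.2
  simp only [alpha, beta, Subgroup.coe_mul, Matrix.SpecialLinearGroup.coe_mul, Matrix.mul_apply,
    Fin.sum_univ_two]
  rw [this]

theorem alpha_mul_conj_sub (g : SU11) :
    alpha g * conj (alpha g) - beta g * conj (beta g) = 1 := by
  have h := g.1.2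
  rw [Matrix.det_fin_two] at h
  have h₁ := g.2.1
  have h₂ := g.2.2
  simp only [alpha, beta]
  rw [← h₁, ← h₂]
  exact h

theorem norm_alpha_sq (g : SU11) : ‖alpha g‖ ^ 2 = 1 + ‖beta g‖ ^ 2 := by
  have h := alpha_mul_conj_sub g
  rw [Complex.mul_conj', Complex.mul_conj'] at h
  have : ‖alpha g‖ ^ 2 - ‖beta g‖ ^ 2 = 1 := by exact_mod_cast h
  linarith

theorem continuous_alpha : Continuous alpha :=
  by
  have h : Continuous fun g : SU11 => (g.1 : Matrix (Fin 2) (Fin 2) ℂ) :=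
    continuous_subtype_val.comp continuous_subtype_val
  exact h.matrix_elem 0 0

theorem continuous_beta : Continuous beta :=
  by
  have h : Continuous fun g : SU11 => (g.1 : Matrix (Fin 2) (Fin 2) ℂ) :=
    continuous_subtype_val.comp continuous_subtype_val
  exact h.matrix_elem 0 1

theorem continuous_of_alpha_beta {Y : Type*} [TopologicalSpace Y] {f : Y → SU11}
    (hα : Continuous fun y => alpha (f y)) (hβ : Continuous fun y => beta (f y)) :
    Continuous f := by
  refine continuous_induced_rng.2 (continuous_induced_rng.2 (continuous_matrix fun i j => ?_))
  fin_cases i <;> fin_cases j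
  · exact hα
  · exact hβ
  · exact (Complex.continuous_conj.comp hβ).congr fun y => (f y).2.1.symm
  · exact (Complex.continuous_conj.comp hα).congr fun y => (f y).2.2.symm

/-- The quadratic form `|x|² - |y|²` on `ℂ²`. -/
noncomputable def coneForm (v : ℂ × ℂ) : ℝ := ‖v.1‖ ^ 2 - ‖v.2‖ ^ 2

theorem continuous_coneForm : Continuous coneForm := by
  unfold coneForm; fun_prop

theorem coneForm_normalize {v : ℂ × ℂ} (hv : 0 < coneForm v) :
    v.1 / (√(coneForm v) : ℝ) * conj (v.1 / (√(coneForm v) : ℝ)) -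
      conj (v.2 / (√(coneForm v) : ℝ)) * conj (conj (v.2 / (√(coneForm v) : ℝ))) = 1 := by
  have h : ((√(coneForm v) : ℝ) : ℂ) ^ 2 = (coneForm v : ℂ) := by
    rw [← Complex.ofReal_pow, Real.sq_sqrt hv.le]
  have h0 : ((√(coneForm v) : ℝ) : ℂ) ≠ 0 := by
    exact_mod_cast (Real.sqrt_pos.2 hv).ne'
  rw [Complex.conj_conj, map_div₀, map_div₀, Complex.conj_ofReal]
  have h1 : v.1 * conj v.1 - v.2 * conj v.2 = (coneForm v : ℂ) := by
    rw [Complex.mul_conj', Complex.mul_conj', coneForm]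
    push_cast
    rfl
  rw [← h] at h1
  field_simp
  linear_combination h1

open Classical in
/-- The element of `SU(1,1)` whose first column is the normalization of a vector of positive
form. -/
noncomputable def coneMap (v : ℂ × ℂ) : SU11 :=
  if h : 0 < coneForm v then
    mk (v.1 / (√(coneForm v) : ℝ)) (conj (v.2 / (√(coneForm v) : ℝ))) (coneForm_normalize h)
  else 1

theorem alpha_coneMap {v : ℂ × ℂ} (h : 0 < coneForm v) :
    alpha (coneMap v) = v.1 / (√(coneForm v) : ℝ) := by
  simp [coneMap, h]

theorem beta_coneMap {v : ℂ × ℂ} (h : 0 < coneForm v) :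
    beta (coneMap v) = conj (v.2 / (√(coneForm v) : ℝ)) := by
  simp [coneMap, h]

theorem continuousOn_coneMap : ContinuousOn coneMap {v | 0 < coneForm v} := by
  rw [continuousOn_iff_continuous_domRestrict]
  have hc : Continuous fun v : {v | 0 < coneForm v} => ((√(coneForm v.1) : ℝ) : ℂ) :=
    Complex.continuous_ofReal.comp
      (Real.continuous_sqrt.comp (continuous_coneForm.comp continuous_subtype_val))
  have h0 : ∀ v : {v | 0 < coneForm v}, ((√(coneForm v.1) : ℝ) : ℂ) ≠ 0 := fun v => by
    exact_mod_cast (Real.sqrt_pos.2 v.2).ne'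
  refine continuous_of_alpha_beta ?_ ?_
  · refine Continuous.congr ?_ fun v => (alpha_coneMap v.2).symm
    exact (continuous_fst.comp continuous_subtype_val).div hc h0
  · refine Continuous.congr ?_ fun v => (beta_coneMap v.2).symm
    exact Complex.continuous_conj.comp ((continuous_snd.comp continuous_subtype_val).div hc h0)

theorem isOpen_coneForm_pos : IsOpen {v | 0 < coneForm v} :=
  isOpen_lt continuous_const continuous_coneForm

theorem measurable_coneMap : Measurable coneMap := by
  refine measurable_of_restrict_of_restrict_compl isOpen_coneForm_pos.measurableSet
    (continuousOn_iff_continuous_domRestrict.1 continuousOn_coneMap).measurable ?_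
  have : Set.domRestrict {v | 0 < coneForm v}ᶜ coneMap = fun _ => 1 := by
    ext1 v
    simp only [Set.domRestrict_apply, coneMap]
    exact dif_neg v.2
  rw [this]
  exact measurable_const

/-- The truncated cone `0 < |x|² - |y|² < 1` in `ℂ²`. -/
def truncatedCone : Set (ℂ × ℂ) := {v | 0 < coneForm v ∧ coneForm v < 1}

theorem isOpen_truncatedCone : IsOpen truncatedCone :=
  isOpen_coneForm_pos.inter (isOpen_lt continuous_coneForm continuous_const)

/-- The push-forward to `SU(1,1)` of the Lebesgue measure on the truncated cone. -/
noncomputable def coneMeasure : Measure SU11 :=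
  (volume.restrict truncatedCone).map coneMap

/-- The linear action of `SU(1,1)` on `ℂ²`. -/
noncomputable def linearAction (g : SU11) : (ℂ × ℂ) →ₗ[ℂ] (ℂ × ℂ) :=
  Matrix.toLin (Module.Basis.finTwoProd ℂ) (Module.Basis.finTwoProd ℂ) g.1.1

theorem linearAction_apply (g : SU11) (v : ℂ × ℂ) :
    linearAction g v = (alpha g * v.1 + beta g * v.2,
      conj (beta g) * v.1 + conj (alpha g) * v.2) := by
  have h₁ := g.2.1
  have h₂ := g.2.2
  have : g.1.1 = !![alpha g, beta g; conj (beta g), conj (alpha g)] := by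
    ext i j
    fin_cases i <;> fin_cases j
    · rfl
    · rfl
    · exact h₁
    · exact h₂
  rw [linearAction, this, Matrix.toLin_finTwoProd_apply]

theorem continuous_linearAction (g : SU11) : Continuous (linearAction g) :=
  LinearMap.continuous_of_finiteDimensional _

theorem measurePreserving_linearAction (g : SU11) :
    MeasurePreserving (linearAction g) volume volume := by
  refine ⟨(continuous_linearAction g).measurable, ?_⟩
  -- The real determinant is the norm from `ℂ` to `ℝ` of the complex determinant, which is 1.
  have hdet : LinearMap.det ((linearAction g).restrictScalars ℝ) = 1 := by
    rw [LinearMap.det_restrictScalars, linearAction, LinearMap.det_toLin]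
    simp
  have : (volume : Measure (ℂ × ℂ)).IsAddHaarMeasure :=
    inferInstanceAs ((volume : Measure ℂ).prod (volume : Measure ℂ)).IsAddHaarMeasure
  have := Measure.map_linearMap_addHaar_eq_smul_addHaar (μ := (volume : Measure (ℂ × ℂ)))
    (f := (linearAction g).restrictScalars ℝ) (by rw [hdet]; exact one_ne_zero)
  rw [hdet] at this
  simpa using this

theorem coneForm_linearAction (g : SU11) (v : ℂ × ℂ) :
    coneForm (linearAction g v) = coneForm v := by
  have h := alpha_mul_conj_sub g
  have key : ((coneForm (linearAction g v) : ℝ) : ℂ) = coneForm v := by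
    simp only [coneForm, linearAction_apply]
    push_cast
    simp only [← Complex.mul_conj', map_add, map_mul, Complex.conj_conj]
    linear_combination (v.1 * conj v.1 - v.2 * conj v.2) * h
  exact_mod_cast key

/-- Equivariance is the source of left invariance: the action preserves the form, hence commutes
with normalization. -/
theorem coneMap_linearAction (g : SU11) {v : ℂ × ℂ} (hv : 0 < coneForm v) :
    coneMap (linearAction g v) = g * coneMap v := by
  have hv' : 0 < coneForm (linearAction g v) := by rwa [coneForm_linearAction]
  apply ext_alpha_beta
  · rw [alpha_mul, alpha_coneMap hv, alpha_coneMap hv', beta_coneMap hv, coneForm_linearAction,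
      linearAction_apply, Complex.conj_conj]
    ring
  · rw [beta_mul, alpha_coneMap hv, beta_coneMap hv', beta_coneMap hv, coneForm_linearAction,
      linearAction_apply]
    simp only [map_div₀, map_add, map_mul, Complex.conj_conj]
    ring

instance isMulLeftInvariant_coneMeasure : coneMeasure.IsMulLeftInvariant := by
  refine ⟨fun g => ?_⟩
  have hg : Measurable fun h : SU11 => g * h := (continuous_const_mul g).measurable
  have hT := (measurePreserving_linearAction g).restrict_preimage
    isOpen_truncatedCone.measurableSet
  have hpre : linearAction g ⁻¹' truncatedCone = truncatedCone := by
    ext v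
    simp [truncatedCone, coneForm_linearAction]
  rw [hpre] at hT
  rw [coneMeasure, Measure.map_map hg measurable_coneMap]
  conv_rhs => rw [← hT.map_eq, Measure.map_map measurable_coneMap hT.measurable]
  refine Measure.map_congr ?_
  filter_upwards [ae_restrict_mem isOpen_truncatedCone.measurableSet] with v hv
  exact (coneMap_linearAction g hv.1).symm

/-- On a compact set `|α| ≤ c`. Undoing the normalization multiplies by `√(coneForm v) ≤ 1`, and
`|y| ≤ |x|` on the cone, so the preimage is bounded. The truncation is needed here. -/
instance isFiniteMeasureOnCompacts_coneMeasure : IsFiniteMeasureOnCompacts coneMeasure := by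
  refine ⟨fun K hK => ?_⟩
  obtain ⟨c, hc⟩ := hK.exists_bound_of_continuousOn continuous_alpha.continuousOn
  rw [coneMeasure, Measure.map_apply measurable_coneMap hK.measurableSet,
    Measure.restrict_apply' isOpen_truncatedCone.measurableSet]
  refine (measure_mono ?_).trans_lt (measure_closedBall_lt_top (x := (0 : ℂ × ℂ)) (r := c))
  rintro v ⟨hvK, hv, hv1⟩
  have h := hc _ hvK
  rw [alpha_coneMap hv, norm_div, Complex.norm_real, Real.norm_of_nonneg (Real.sqrt_nonneg _),
    div_le_iff₀ (Real.sqrt_pos.2 hv)] at h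
  have hs : √(coneForm v) ≤ 1 := Real.sqrt_le_one.2 hv1.le
  have hs0 := Real.sqrt_pos.2 hv
  have hc0 : 0 ≤ c := by
    by_contra! hneg
    nlinarith [norm_nonneg v.1, mul_neg_of_neg_of_pos hneg hs0]
  have h1 : ‖v.1‖ ≤ c := by nlinarith
  have h2 : ‖v.2‖ ≤ ‖v.1‖ := by
    rw [coneForm] at hv
    exact abs_le_of_sq_le_sq' (by linarith) (norm_nonneg _) |>.2
  rw [mem_closedBall_zero_iff, Prod.norm_def]
  exact max_le h1 (h2.trans h1)

instance isOpenPosMeasure_coneMeasure : coneMeasure.IsOpenPosMeasure := by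
  refine ⟨fun U hU ⟨u, hu⟩ => ?_⟩
  rw [coneMeasure, Measure.map_apply measurable_coneMap hU.measurableSet,
    Measure.restrict_apply' isOpen_truncatedCone.measurableSet, Set.inter_comm]
  -- Half the first column of `u` has form `1/4`, so it lies inside the truncated cone, and it
  -- normalizes back to `u`.
  refine ((continuousOn_coneMap.mono fun v hv => hv.1).isOpen_inter_preimage
    isOpen_truncatedCone hU).measure_ne_zero _ ⟨(alpha u / 2, conj (beta u) / 2), ?_⟩
  have hq : coneForm (alpha u / 2, conj (beta u) / 2) = (1 / 2) ^ 2 := by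
    have := norm_alpha_sq u
    simp only [coneForm, norm_div, RCLike.norm_conj, Complex.norm_ofNat]
    linarith
  have hpos : 0 < coneForm (alpha u / 2, conj (beta u) / 2) := by rw [hq]; norm_num
  refine ⟨⟨hpos, by rw [hq]; norm_num⟩, ?_⟩
  have : coneMap (alpha u / 2, conj (beta u) / 2) = u := by
    apply ext_alpha_beta
    · rw [alpha_coneMap hpos, hq, Real.sqrt_sq (by norm_num)]
      push_cast
      field_simp
    · rw [beta_coneMap hpos, hq, Real.sqrt_sq (by norm_num)]
      simp
  rw [Set.mem_preimage, this]
  exact hu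

theorem isHaarMeasure_coneMeasure : coneMeasure.IsHaarMeasure where

end Cone

end SU11

namespace SU11

/-! ### Comparison of the coordinate measure with the cone measure. -/

section Haar

open MeasureTheory Set
open scoped Real ENNReal

theorem hasDerivAt_tanh_half (τ : ℝ) :
    HasDerivAt (fun τ : ℝ => Real.tanh (τ / 2)) (1 / (2 * Real.cosh (τ / 2) ^ 2)) τ := by
  have hc : Real.cosh (τ / 2) ≠ 0 := (Real.cosh_pos _).ne'
  have h2 : HasDerivAt (fun τ : ℝ => τ / 2) (1 / 2) τ := (hasDerivAt_id τ).div_const 2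
  have h := (h2.sinh).div (h2.cosh) hc
  have e : (fun τ : ℝ => Real.tanh (τ / 2)) =
      (fun τ : ℝ => Real.sinh (τ / 2)) / fun τ : ℝ => Real.cosh (τ / 2) := by
    ext τ
    simp [Real.tanh_eq_sinh_div_cosh]
  rw [e]
  have h3 := Real.cosh_sq_sub_sinh_sq (τ / 2)
  have h4 : 1 / (2 * Real.cosh (τ / 2) ^ 2) =
      (Real.cosh (τ / 2) * (1 / 2) * Real.cosh (τ / 2) -
        Real.sinh (τ / 2) * (Real.sinh (τ / 2) * (1 / 2))) / Real.cosh (τ / 2) ^ 2 := by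
    rw [div_eq_div_iff (by positivity) (by positivity)]
    linear_combination (-Real.cosh (τ / 2) ^ 2) * h3
  rw [h4]
  exact h

theorem tanh_half_pos {τ : ℝ} (h : 0 < τ) : 0 < Real.tanh (τ / 2) := by
  rw [Real.tanh_eq_sinh_div_cosh]
  exact div_pos (Real.sinh_pos_iff.2 (by linarith)) (Real.cosh_pos _)

theorem injective_mul_tanh_half {r : ℝ} (hr : 0 < r) :
    Function.Injective fun τ : ℝ => r * Real.tanh (τ / 2) := fun x y h => by
  have := Real.tanh_injective (mul_left_cancel₀ hr.ne' h)
  linarith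

theorem image_mul_tanh_half {r : ℝ} (hr : 0 < r) :
    (fun τ : ℝ => r * Real.tanh (τ / 2)) '' Ioi 0 = Ioo 0 r := by
  ext x
  constructor
  · rintro ⟨τ, hτ, rfl⟩
    exact ⟨mul_pos hr (tanh_half_pos hτ), by nlinarith [Real.tanh_lt_one (τ / 2)]⟩
  · rintro ⟨h0, h1⟩
    have hx : x / r ∈ Ioo (0 : ℝ) 1 := ⟨div_pos h0 hr, (div_lt_one hr).2 h1⟩
    refine ⟨2 * Real.artanh (x / r), ?_, ?_⟩
    · have := Real.artanh_pos hx
      simp only [mem_Ioi]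
      linarith
    · have := Real.tanh_artanh (x := x / r) ⟨by linarith [hx.1], hx.2⟩
      simp only [mul_div_cancel_left₀ _ (two_ne_zero' ℝ), this]
      field_simp

theorem lintegral_Ioo_eq_lintegral_tanh {r : ℝ} (hr : 0 < r) (F : ℝ → ℝ≥0∞) :
    ∫⁻ s in Ioo 0 r, F s = ∫⁻ τ in Ioi 0,
      ENNReal.ofReal (r / (2 * Real.cosh (τ / 2) ^ 2)) * F (r * Real.tanh (τ / 2)) := by
  rw [← image_mul_tanh_half hr, lintegral_image_eq_lintegral_abs_deriv_mul measurableSet_Ioi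
    (fun τ _ => ((hasDerivAt_tanh_half τ).const_mul r).hasDerivWithinAt)
    (injective_mul_tanh_half hr).injOn]
  refine lintegral_congr fun τ => ?_
  rw [mul_one_div, abs_of_nonneg (by positivity)]

/-- The element with `α = cosh (τ/2) e^{ia}` and `β = sinh (τ/2) e^{-ib}`. -/
noncomputable def polarElement (τ a b : ℝ) : SU11 :=
  mk ((Real.cosh (τ / 2) : ℝ) * Complex.exp (a * Complex.I))
    ((Real.sinh (τ / 2) : ℝ) * Complex.exp (-(b * Complex.I))) (by
      have h1 : Complex.exp (a * Complex.I) * Complex.exp (-(a * Complex.I)) = 1 := by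
        rw [← Complex.exp_add, add_neg_cancel, Complex.exp_zero]
      have h2 : Complex.exp (b * Complex.I) * Complex.exp (-(b * Complex.I)) = 1 := by
        rw [← Complex.exp_add, add_neg_cancel, Complex.exp_zero]
      have h3 : ((Real.cosh (τ / 2) : ℝ) : ℂ) ^ 2 - ((Real.sinh (τ / 2) : ℝ) : ℂ) ^ 2 = 1 := by
        exact_mod_cast Real.cosh_sq_sub_sinh_sq (τ / 2)
      simp only [map_mul, Complex.conj_ofReal, ← Complex.exp_conj, map_neg, Complex.conj_I,
        mul_neg, neg_neg]
      linear_combination ((Real.cosh (τ / 2) : ℝ) : ℂ) ^ 2 * h1 -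
        ((Real.sinh (τ / 2) : ℝ) : ℂ) ^ 2 * h2 + h3)

theorem continuous_polarElement :
    Continuous fun p : ℝ × ℝ × ℝ => polarElement p.1 p.2.1 p.2.2 := by
  refine continuous_of_alpha_beta ?_ ?_ <;> simp only [polarElement, alpha_mk, beta_mk] <;>
    fun_prop

theorem alpha_param (τ φ ψ : ℝ) : alpha (param (τ, φ, ψ)) =
    (Real.cosh (τ / 2) : ℝ) * Complex.exp (((φ + ψ) / 2 : ℝ) * Complex.I) := by
  simp only [param, alpha_mul, beta_mul, rotation, boost, alpha_mk, beta_mk, map_zero, mul_zero,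
    zero_mul, add_zero]
  rw [mul_comm (Complex.exp _), mul_assoc, ← Complex.exp_add]
  congr 2
  push_cast
  ring

theorem beta_param (τ φ ψ : ℝ) : beta (param (τ, φ, ψ)) =
    (Real.sinh (τ / 2) : ℝ) * Complex.exp (((φ - ψ) / 2 : ℝ) * Complex.I) := by
  simp only [param, alpha_mul, beta_mul, rotation, boost, alpha_mk, beta_mk, mul_zero, zero_mul,
    add_zero, zero_add]
  rw [mul_comm (Complex.exp _), mul_assoc, ← Complex.exp_conj, ← Complex.exp_add]
  congr 2
  simp only [map_mul, Complex.conj_I, Complex.conj_ofReal]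
  push_cast
  ring

theorem param_eq_polarElement (τ φ ψ : ℝ) :
    param (τ, φ, ψ) = polarElement τ ((φ + ψ) / 2) ((ψ - φ) / 2) := by
  apply ext_alpha_beta
  · rw [alpha_param, polarElement, alpha_mk]
  · rw [beta_param, polarElement, beta_mk]
    congr 2
    push_cast
    ring

theorem continuous_param : Continuous param := by
  have h : param = fun p : ℝ × ℝ × ℝ =>
      polarElement p.1 ((p.2.1 + p.2.2) / 2) ((p.2.2 - p.2.1) / 2) := by
    ext1 p
    exact param_eq_polarElement _ _ _
  rw [h]
  exact continuous_polarElement.comp (g := fun p : ℝ × ℝ × ℝ => polarElement p.1 p.2.1 p.2.2)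
    (f := fun p : ℝ × ℝ × ℝ => (p.1, (p.2.1 + p.2.2) / 2, (p.2.2 - p.2.1) / 2)) (by fun_prop)

theorem polarElement_add_two_pi_left (τ a b : ℝ) :
    polarElement τ (a + 2 * π) b = polarElement τ a b := by
  apply ext_alpha_beta
  · simp only [polarElement, alpha_mk]
    push_cast
    rw [add_mul, Complex.exp_periodic]
  · simp only [polarElement, beta_mk]

theorem polarElement_add_two_pi_right (τ a b : ℝ) :
    polarElement τ a (b + 2 * π) = polarElement τ a b := by
  apply ext_alpha_beta
  · simp only [polarElement, alpha_mk]
  · simp only [polarElement, beta_mk]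
    push_cast
    rw [add_mul, neg_add, ← sub_eq_add_neg, Complex.exp_periodic.sub_eq]

theorem lintegral_Ioc_add_eq_of_periodic {T : ℝ} (hT : 0 < T) {f : ℝ → ℝ≥0∞}
    (hf : Function.Periodic f T) (s t : ℝ) :
    ∫⁻ x in Ioc s (s + T), f x = ∫⁻ x in Ioc t (t + T), f x := by
  have : VAddInvariantMeasure (AddSubgroup.zmultiples T) ℝ volume :=
    ⟨fun c s _ => measure_preimage_add _ _ _⟩
  apply IsAddFundamentalDomain.setLIntegral_eq (G := AddSubgroup.zmultiples T)
  exacts [isAddFundamentalDomain_Ioc hT s, isAddFundamentalDomain_Ioc hT t, hf.map_vadd_zmultiples]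

theorem lintegral_Ico_affine {c d s t : ℝ} (hc : 0 < c) (f : ℝ → ℝ≥0∞) :
    ∫⁻ x in Ico (c * s + d) (c * t + d), f x =
      ENNReal.ofReal c * ∫⁻ x in Ico s t, f (c * x + d) := by
  have h : (fun x => c * x + d) '' Ico s t = Ico (c * s + d) (c * t + d) := by
    rw [← image_image (fun x => x + d) (fun x => c * x), image_mul_left_Ico hc,
      image_add_const_Ico]
  rw [← h, lintegral_image_eq_lintegral_abs_deriv_mul measurableSet_Ico
    (fun x _ => (((hasDerivAt_id' x).const_mul c).add_const d).hasDerivWithinAt)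
    (fun x _ y _ hxy => mul_left_cancel₀ hc.ne' (add_right_cancel hxy)),
    mul_one, abs_of_pos hc, lintegral_const_mul' _ _ ENNReal.ofReal_ne_top]

/-- For fixed `φ` put `ψ = 2a - φ`, which gives the factor 2 and `b = a - φ`. The variable `a` runs
over an interval of length `2π` depending on `φ`, moved to a fixed one by periodicity; after
exchanging the integrals, `φ` is replaced by `b` in the same way. -/
theorem lintegral_angles {h : ℝ → ℝ → ℝ≥0∞} (hm : Measurable (Function.uncurry h))
    (h₁ : ∀ a b, h (a + 2 * π) b = h a b) (h₂ : ∀ a b, h a (b + 2 * π) = h a b) :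
    ∫⁻ φ in Ico 0 (2 * π), ∫⁻ ψ in Ico (-(2 * π)) (2 * π), h ((φ + ψ) / 2) ((ψ - φ) / 2) =
      2 * ∫⁻ a in Ioo (-π) π, ∫⁻ b in Ioo (-π) π, h a b := by
  have hpi : 0 < 2 * π := Real.two_pi_pos
  have hIoc : ∀ (f : ℝ → ℝ≥0∞) (s t : ℝ), ∫⁻ x in Ico s t, f x = ∫⁻ x in Ioc s t, f x :=
    fun f s t => setLIntegral_congr Ico_ae_eq_Ioc
  have hIoo : ∀ f : ℝ → ℝ≥0∞, ∫⁻ x in Ioo (-π) π, f x = ∫⁻ x in Ioc (-π) (-π + 2 * π), f x := by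
    intro f
    rw [show -π + 2 * π = π by ring]
    exact setLIntegral_congr Ioo_ae_eq_Ioc
  have hinner : ∀ φ, ∫⁻ ψ in Ico (-(2 * π)) (2 * π), h ((φ + ψ) / 2) ((ψ - φ) / 2) =
      2 * ∫⁻ a in Ioc (-π) (-π + 2 * π), h a (a - φ) := by
    intro φ
    have := lintegral_Ico_affine (c := 2) (d := -φ) (s := φ / 2 - π) (t := φ / 2 + π) two_pos
      fun ψ => h ((φ + ψ) / 2) ((ψ - φ) / 2)
    rw [show 2 * (φ / 2 - π) + -φ = -(2 * π) by ring,
      show 2 * (φ / 2 + π) + -φ = 2 * π by ring] at this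
    rw [this, ENNReal.ofReal_ofNat, hIoc, show φ / 2 + π = φ / 2 - π + 2 * π by ring]
    congr 1
    rw [← lintegral_Ioc_add_eq_of_periodic hpi (f := fun a => h a (a - φ))
      (fun a => by beta_reduce; rw [h₁, add_sub_right_comm, h₂]) (φ / 2 - π)]
    refine lintegral_congr fun a => ?_
    congr 1 <;> ring
  simp only [hinner]
  rw [lintegral_const_mul' _ _ ENNReal.ofNat_ne_top, hIoo]
  congr 1
  rw [lintegral_lintegral_swap]
  · refine lintegral_congr fun a => ?_
    have himg : (fun x => a - x) '' Ico 0 (2 * π) = Ioc (a - 2 * π) (a - 2 * π + 2 * π) := by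
      rw [image_const_sub_Ico, sub_zero, sub_add_cancel]
    rw [hIoo, ← lintegral_Ioc_add_eq_of_periodic hpi (h₂ a) (a - 2 * π), ← himg,
      lintegral_image_eq_lintegral_abs_deriv_mul measurableSet_Ico
        (fun x _ => ((hasDerivAt_id' x).const_sub a).hasDerivWithinAt)
        (fun x _ y _ hxy => sub_right_injective hxy)]
    simp
  · exact (hm.comp (measurable_snd.prodMk (measurable_snd.sub measurable_fst))).aemeasurable

theorem coneForm_polar {r : ℝ} (τ a b : ℝ) :
    coneForm (r * Complex.exp (a * Complex.I),
      (r * Real.tanh (τ / 2) : ℝ) * Complex.exp (b * Complex.I)) =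
        (r / Real.cosh (τ / 2)) ^ 2 := by
  have hc := (Real.cosh_pos (τ / 2)).ne'
  have := Real.cosh_sq_sub_sinh_sq (τ / 2)
  simp only [coneForm, norm_mul, Complex.norm_exp_ofReal_mul_I, Complex.norm_real, mul_one,
    Real.norm_eq_abs, sq_abs, ← abs_mul, Real.tanh_eq_sinh_div_cosh]
  field_simp
  rw [this, mul_one]

theorem coneMap_polar {r : ℝ} (hr : 0 < r) (τ a b : ℝ) :
    coneMap (r * Complex.exp (a * Complex.I),
      (r * Real.tanh (τ / 2) : ℝ) * Complex.exp (b * Complex.I)) = polarElement τ a b := by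
  have hc := Real.cosh_pos (τ / 2)
  have hq := coneForm_polar (r := r) τ a b
  have hpos : 0 < coneForm (r * Complex.exp (a * Complex.I),
      (r * Real.tanh (τ / 2) : ℝ) * Complex.exp (b * Complex.I)) := by
    rw [hq]; positivity
  have hr' : (r : ℂ) ≠ 0 := by exact_mod_cast hr.ne'
  have hc' : ((Real.cosh (τ / 2) : ℝ) : ℂ) ≠ 0 := by exact_mod_cast hc.ne'
  apply ext_alpha_beta
  · rw [alpha_coneMap hpos, hq, Real.sqrt_sq (by positivity), polarElement, alpha_mk]
    push_cast
    push_cast at hc'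
    field_simp
  · rw [beta_coneMap hpos, hq, Real.sqrt_sq (by positivity), polarElement, beta_mk,
      Real.tanh_eq_sinh_div_cosh]
    simp only [map_div₀, map_mul, Complex.conj_ofReal, ← Complex.exp_conj, Complex.conj_I,
      mul_neg]
    push_cast
    push_cast at hc'
    field_simp

theorem mem_truncatedCone_polar {r : ℝ} (hr : 0 < r) (τ a b : ℝ) :
    ((r * Complex.exp (a * Complex.I),
      (r * Real.tanh (τ / 2) : ℝ) * Complex.exp (b * Complex.I)) : ℂ × ℂ) ∈ truncatedCone ↔
        r < Real.cosh (τ / 2) := by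
  have hc := Real.cosh_pos (τ / 2)
  simp only [truncatedCone, mem_ofPred_eq, coneForm_polar]
  rw [sq_lt_one_iff₀ (by positivity), div_lt_one hc]
  exact ⟨fun h => h.2, fun h => ⟨by positivity, h⟩⟩

theorem lintegral_complex_polar {f : ℂ → ℝ≥0∞} (hf : Measurable f) :
    ∫⁻ z, f z = ∫⁻ r in Ioi (0 : ℝ), ENNReal.ofReal r *
      ∫⁻ a in Ioo (-π) π, f (r * Complex.exp (a * Complex.I)) := by
  rw [← Complex.lintegral_comp_polarCoord_symm, polarCoord_target, Measure.volume_eq_prod,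
    setLIntegral_prod]
  · refine lintegral_congr fun r => ?_
    rw [← lintegral_const_mul' _ _ ENNReal.ofReal_ne_top]
    refine lintegral_congr fun a => ?_
    rw [Complex.polarCoord_symm_apply, Complex.exp_mul_I, smul_eq_mul]
    push_cast
    rfl
  · refine Measurable.aemeasurable ?_
    simp only [Complex.polarCoord_symm_apply, smul_eq_mul]
    fun_prop

/-- Integrates out the radius: one factor `r` is the polar Jacobian of the first component, and `r²`
comes from the second. -/
theorem lintegral_pow_three (τ : ℝ) (hτ : 0 < τ) :
    ∫⁻ r in Ioo 0 (Real.cosh (τ / 2)),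
      ENNReal.ofReal (r ^ 3 * Real.sinh (τ / 2) / (2 * Real.cosh (τ / 2) ^ 3)) =
        ENNReal.ofReal (Real.sinh τ / 16) := by
  have hc := Real.cosh_pos (τ / 2)
  have hs : 0 < Real.sinh (τ / 2) := Real.sinh_pos_iff.2 (by linarith)
  rw [setLIntegral_congr Ioo_ae_eq_Ioc, ← ofReal_integral_eq_lintegral_ofReal,
    ← intervalIntegral.integral_of_le hc.le]
  · congr 1
    rw [intervalIntegral.integral_div, intervalIntegral.integral_mul_const, integral_pow,
      show τ = 2 * (τ / 2) by ring, Real.sinh_two_mul, show 2 * (τ / 2) / 2 = τ / 2 by ring]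
    field_simp
    ring
  · exact ((Continuous.intervalIntegrable (by fun_prop) _ _ :
      IntervalIntegrable _ volume 0 (Real.cosh (τ / 2))).1)
  · filter_upwards [ae_restrict_mem measurableSet_Ioc] with r hr
    have := hr.1
    positivity

/-- Polar coordinates in `y` with modulus `s = r tanh (τ/2)`: positivity of the form means `s < r`,
and form less than 1 means `r < cosh (τ/2)`. The density is `s ds/dτ`. -/
theorem lintegral_truncatedCone_fiber (f : SU11 → ℝ≥0∞) (hf : Measurable f) {r : ℝ}
    (hr : 0 < r) (a : ℝ) :
    ∫⁻ y : ℂ, truncatedCone.indicator (fun v => f (coneMap v))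
        (r * Complex.exp (a * Complex.I), y) =
      ∫⁻ τ in Ioi 0, (Iio (Real.cosh (τ / 2))).indicator (fun r => ENNReal.ofReal
        (r ^ 2 * Real.sinh (τ / 2) / (2 * Real.cosh (τ / 2) ^ 3))) r *
          ∫⁻ b in Ioo (-π) π, f (polarElement τ a b) := by
  have hG : Measurable (truncatedCone.indicator fun v => f (coneMap v)) :=
    (hf.comp measurable_coneMap).indicator isOpen_truncatedCone.measurableSet
  rw [lintegral_complex_polar (f := fun y => truncatedCone.indicator (fun v => f (coneMap v))
    (r * Complex.exp (a * Complex.I), y)) (hG.comp measurable_prodMk_left)]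
  have h : ∀ F : ℝ → ℝ≥0∞, (∀ s, r ≤ s → F s = 0) →
      ∫⁻ s in Ioi 0, F s = ∫⁻ s in Ioo 0 r, F s := by
    intro F hF
    rw [← lintegral_indicator measurableSet_Ioi, ← lintegral_indicator measurableSet_Ioo]
    refine lintegral_congr fun s => ?_
    by_cases hs : 0 < s <;> by_cases hsr : s < r <;> simp [indicator, hs, hsr]
    exact hF s (not_lt.1 hsr)
  rw [h, lintegral_Ioo_eq_lintegral_tanh hr]
  · refine setLIntegral_congr_fun measurableSet_Ioi fun τ hτ => ?_
    have hc := Real.cosh_pos (τ / 2)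
    have ht := tanh_half_pos hτ
    by_cases hrτ : r < Real.cosh (τ / 2)
    · rw [indicator_of_mem (mem_Iio.2 hrτ), ← mul_assoc, ← ENNReal.ofReal_mul (by positivity)]
      congr 1
      · congr 1
        rw [Real.tanh_eq_sinh_div_cosh]
        field_simp
      · refine lintegral_congr fun b => ?_
        rw [indicator_of_mem ((mem_truncatedCone_polar hr τ a b).2 hrτ),
          coneMap_polar hr]
    · rw [indicator_of_notMem (by simpa using hrτ), zero_mul]
      have : ∀ b : ℝ, truncatedCone.indicator (fun v => f (coneMap v))
          (r * Complex.exp (a * Complex.I),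
            (r * Real.tanh (τ / 2) : ℝ) * Complex.exp (b * Complex.I)) = 0 := fun b =>
        indicator_of_notMem (fun h => hrτ ((mem_truncatedCone_polar hr τ a b).1 h)) _
      simp only [this, lintegral_zero, mul_zero]
  · intro s hs
    have : ∀ b : ℝ, truncatedCone.indicator (fun v => f (coneMap v))
        (r * Complex.exp (a * Complex.I), s * Complex.exp (b * Complex.I)) = 0 := by
      refine fun b => indicator_of_notMem (fun h => ?_) _
      have h1 := h.1
      simp only [coneForm, norm_mul, Complex.norm_exp_ofReal_mul_I, Complex.norm_real, mul_one,
        Real.norm_eq_abs, sq_abs] at h1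
      nlinarith
    simp only [this, lintegral_zero, mul_zero]

theorem lintegral_mul_lintegral_lintegral_mul {W H : ℝ × ℝ → ℝ≥0∞} (hW : Measurable W)
    (hH : Measurable H) (μ ν ρ : Measure ℝ) [SFinite μ] [SFinite ν] [SFinite ρ] :
    ∫⁻ r, ENNReal.ofReal r * ∫⁻ a, ∫⁻ τ, W (r, τ) * H (τ, a) ∂ρ ∂ν ∂μ =
      ∫⁻ τ, (∫⁻ r, ENNReal.ofReal r * W (r, τ) ∂μ) * ∫⁻ a, H (τ, a) ∂ν ∂ρ := by
  have hH' : Measurable fun τ => ∫⁻ a, H (τ, a) ∂ν := hH.lintegral_prod_right'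
  calc _ = ∫⁻ r, ∫⁻ τ, ENNReal.ofReal r * W (r, τ) * ∫⁻ a, H (τ, a) ∂ν ∂ρ ∂μ := by
        refine lintegral_congr fun r => ?_
        rw [lintegral_lintegral_swap, ← lintegral_const_mul' _ _ ENNReal.ofReal_ne_top]
        · refine lintegral_congr fun τ => ?_
          rw [lintegral_const_mul (W (r, τ)) (f := fun a => H (τ, a))
            (hH.comp measurable_prodMk_left), mul_assoc]
        · exact Measurable.aemeasurable (by fun_prop)
    _ = ∫⁻ τ, ∫⁻ r, ENNReal.ofReal r * W (r, τ) * ∫⁻ a, H (τ, a) ∂ν ∂μ ∂ρ := by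
        rw [lintegral_lintegral_swap]
        exact Measurable.aemeasurable (by fun_prop)
    _ = _ := by
        refine lintegral_congr fun τ => ?_
        rw [lintegral_mul_const]
        exact Measurable.mul (by fun_prop) (hW.comp measurable_prodMk_right)

theorem lintegral_coneMeasure {f : SU11 → ℝ≥0∞} (hf : Measurable f) :
    ∫⁻ g, f g ∂coneMeasure = ∫⁻ τ in Ioi 0, ENNReal.ofReal (Real.sinh τ / 16) *
      ∫⁻ a in Ioo (-π) π, ∫⁻ b in Ioo (-π) π, f (polarElement τ a b) := by
  have hG : Measurable (truncatedCone.indicator fun v => f (coneMap v)) :=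
    (hf.comp measurable_coneMap).indicator isOpen_truncatedCone.measurableSet
  have hf' : Measurable fun p : (ℝ × ℝ) × ℝ => f (polarElement p.1.1 p.1.2 p.2) :=
    hf.comp (continuous_polarElement.comp
      (f := fun p : (ℝ × ℝ) × ℝ => (p.1.1, p.1.2, p.2)) (by fun_prop)).measurable
  have hH : Measurable fun p : ℝ × ℝ => ∫⁻ b in Ioo (-π) π, f (polarElement p.1 p.2 b) :=
    hf'.lintegral_prod_right'
  have hW : Measurable fun p : ℝ × ℝ => (Iio (Real.cosh (p.2 / 2))).indicator
      (fun r => ENNReal.ofReal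
        (r ^ 2 * Real.sinh (p.2 / 2) / (2 * Real.cosh (p.2 / 2) ^ 3))) p.1 := by
    have : MeasurableSet {p : ℝ × ℝ | p.1 < Real.cosh (p.2 / 2)} :=
      measurableSet_lt measurable_fst (by fun_prop)
    refine Measurable.ite (p := fun p : ℝ × ℝ => p.1 < Real.cosh (p.2 / 2)) this ?_
      measurable_const
    fun_prop
  rw [coneMeasure, lintegral_map hf measurable_coneMap,
    ← lintegral_indicator isOpen_truncatedCone.measurableSet, Measure.volume_eq_prod,
    lintegral_prod _ hG.aemeasurable, lintegral_complex_polar hG.lintegral_prod_right']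
  calc _ = ∫⁻ r in Ioi 0, ENNReal.ofReal r * ∫⁻ a in Ioo (-π) π, ∫⁻ τ in Ioi 0,
          (Iio (Real.cosh (τ / 2))).indicator (fun r => ENNReal.ofReal
            (r ^ 2 * Real.sinh (τ / 2) / (2 * Real.cosh (τ / 2) ^ 3))) r *
              ∫⁻ b in Ioo (-π) π, f (polarElement τ a b) := by
        refine setLIntegral_congr_fun measurableSet_Ioi fun r hr => ?_
        exact congrArg (ENNReal.ofReal r * ·) (lintegral_congr fun a =>
          lintegral_truncatedCone_fiber f hf hr a)
    _ = ∫⁻ τ in Ioi 0, (∫⁻ r in Ioi 0, ENNReal.ofReal r *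
          (Iio (Real.cosh (τ / 2))).indicator (fun r => ENNReal.ofReal
            (r ^ 2 * Real.sinh (τ / 2) / (2 * Real.cosh (τ / 2) ^ 3))) r) *
              ∫⁻ a in Ioo (-π) π, ∫⁻ b in Ioo (-π) π, f (polarElement τ a b) :=
        lintegral_mul_lintegral_lintegral_mul hW hH _ _ _
    _ = _ := by
        refine setLIntegral_congr_fun measurableSet_Ioi fun τ hτ => ?_
        refine congrArg (· * ∫⁻ a in Ioo (-π) π, ∫⁻ b in Ioo (-π) π, f (polarElement τ a b)) ?_
        rw [← lintegral_pow_three τ hτ, ← lintegral_indicator measurableSet_Ioi,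
          ← lintegral_indicator measurableSet_Ioo]
        refine lintegral_congr fun r => ?_
        by_cases hr : 0 < r <;> by_cases hrτ : r < Real.cosh (τ / 2) <;>
          simp [indicator, hr, hrτ]
        rw [← ENNReal.ofReal_mul hr.le]
        congr 1
        ring

theorem lintegral_haar {f : SU11 → ℝ≥0∞} (hf : Measurable f) :
    ∫⁻ g, f g ∂haar = ∫⁻ τ in Ioi 0, ENNReal.ofReal (Real.sinh τ / (8 * π ^ 2)) *
      (2 * ∫⁻ a in Ioo (-π) π, ∫⁻ b in Ioo (-π) π, f (polarElement τ a b)) := by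
  have hp := continuous_param.measurable
  rw [haar, lintegral_map hf hp, lintegral_withDensity_eq_lintegral_mul _ (by fun_prop)
    (show Measurable fun p => f (param p) from hf.comp hp), Measure.volume_eq_prod, setLIntegral_prod]
  · rw [setLIntegral_congr Ioi_ae_eq_Ici.symm]
    refine lintegral_congr fun τ => ?_
    have hm : Measurable (Function.uncurry fun a b => f (polarElement τ a b)) := by
      refine hf.comp (continuous_polarElement.comp
        (f := fun p : ℝ × ℝ => (τ, p.1, p.2)) (by fun_prop)).measurable
    rw [← lintegral_angles hm, Measure.volume_eq_prod, setLIntegral_prod]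
    · simp only [Pi.mul_apply, param_eq_polarElement]
      rw [← lintegral_const_mul' _ _ ENNReal.ofReal_ne_top]
      refine lintegral_congr fun φ => ?_
      rw [← lintegral_const_mul' _ _ ENNReal.ofReal_ne_top]
      refine lintegral_congr fun ψ => ?_
      congr 2
      ring
    · refine Measurable.aemeasurable ?_
      exact ((ENNReal.measurable_ofReal.comp (by fun_prop)).mul (hf.comp hp)).comp
        measurable_prodMk_left
    · intro a b
      rw [polarElement_add_two_pi_left]
    · intro a b
      rw [polarElement_add_two_pi_right]
  · refine Measurable.aemeasurable ?_
    exact (ENNReal.measurable_ofReal.comp (by fun_prop)).mul (hf.comp hp)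

/-- The constant is the ratio of `2/(8π²)`, with the 2 from the change of angles, to `1/16`. -/
theorem haar_eq_smul_coneMeasure : haar = ENNReal.ofReal (4 / π ^ 2) • coneMeasure := by
  refine Measure.ext_of_lintegral _ fun f hf => ?_
  rw [lintegral_smul_measure, lintegral_haar hf, lintegral_coneMeasure hf, smul_eq_mul,
    ← lintegral_const_mul' _ _ ENNReal.ofReal_ne_top]
  refine setLIntegral_congr_fun measurableSet_Ioi fun τ hτ => ?_
  rw [← mul_assoc, ← mul_assoc, ← ENNReal.ofReal_mul (by positivity)]
  congr 1
  rw [← ENNReal.ofReal_ofNat, ← ENNReal.ofReal_mul' (by norm_num)]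
  congr 1
  field_simp
  ring

theorem isHaarMeasure_haar : haar.IsHaarMeasure := by
  have := isHaarMeasure_coneMeasure
  rw [haar_eq_smul_coneMeasure]
  exact Measure.IsHaarMeasure.smul _ (by simpa using by positivity) ENNReal.ofReal_ne_top

end Haar

end SU11

namespace SU11

/-! ### Matrix elements in coordinates. -/

section MatrixElement

open MeasureTheory Set
open scoped Real

theorem intervalIntegral_exp_eq_zero {A a b : ℝ} (hA : A ≠ 0)
    (hab : Complex.exp (A * b * Complex.I) = Complex.exp (A * a * Complex.I)) :
    ∫ x in a..b, Complex.exp (A * x * Complex.I) = 0 := by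
  have hA' : (A : ℂ) * Complex.I ≠ 0 :=
    mul_ne_zero (by exact_mod_cast hA) Complex.I_ne_zero
  have h := integral_exp_mul_complex (a := a) (b := b) hA'
  simp only [mul_right_comm _ Complex.I] at h
  rw [h, hab, sub_self, zero_div]

theorem integral_Ioo_exp (j n : ℕ) :
    ∫ θ in Ioo (-π) π, Complex.exp (((j : ℝ) - n : ℝ) * θ * Complex.I) =
      if j = n then 2 * π else 0 := by
  rw [← integral_Ioc_eq_integral_Ioo, ← intervalIntegral.integral_of_le (by linarith [Real.pi_pos])]
  split_ifs with h
  · subst h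
    simp
    ring
  · refine intervalIntegral_exp_eq_zero (sub_ne_zero.2 (by exact_mod_cast h)) ?_
    rw [Complex.exp_eq_exp_iff_exists_int]
    refine ⟨j - n, ?_⟩
    push_cast
    ring

theorem integral_ball_monomial (b n j : ℕ) :
    ∫ z in Metric.ball (0 : ℂ) 1, conj (z ^ n) * z ^ j * (((1 - ‖z‖ ^ 2) ^ b : ℝ) : ℂ) =
      if j = n then (π * (n.factorial * b.factorial / (n + b + 1).factorial) : ℝ) else 0 := by
  rw [← integral_indicator measurableSet_ball, ← Complex.integral_comp_polarCoord_symm,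
    polarCoord_target, Measure.volume_eq_prod]
  have h : ∀ p ∈ Ioi (0 : ℝ) ×ˢ Ioo (-π) π, p.1 • (Metric.ball (0 : ℂ) 1).indicator
      (fun z : ℂ => conj (z ^ n) * z ^ j * (((1 - ‖z‖ ^ 2) ^ b : ℝ) : ℂ))
        (Complex.polarCoord.symm p) =
      (((Iio 1).indicator (fun r : ℝ => r * (1 - r ^ 2) ^ b * r ^ (n + j)) p.1 : ℝ) : ℂ) *
        Complex.exp (((j : ℝ) - n : ℝ) * p.2 * Complex.I) := by
    rintro ⟨r, θ⟩ ⟨hr, -⟩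
    have hr : 0 < r := hr
    have e : Complex.polarCoord.symm (r, θ) = r * Complex.exp (θ * Complex.I) := by
      rw [Complex.polarCoord_symm_apply, Complex.exp_mul_I]
      push_cast
      rfl
    have hnorm : ‖(r : ℂ) * Complex.exp (θ * Complex.I)‖ = r := by
      rw [norm_mul, Complex.norm_exp_ofReal_mul_I, mul_one, Complex.norm_real,
        Real.norm_of_nonneg hr.le]
    rw [e]
    by_cases h1 : r < 1
    · rw [indicator_of_mem (by rw [mem_ball_zero_iff, hnorm]; exact h1), indicator_of_mem (mem_Iio.2 h1), hnorm]
      simp only [mul_pow, map_mul, map_pow, Complex.conj_ofReal, ← Complex.exp_nat_mul,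
        ← Complex.exp_conj, Complex.conj_I, Complex.real_smul, Complex.conj_natCast]
      have : Complex.exp (((j : ℝ) - n : ℝ) * θ * Complex.I) =
          Complex.exp (n * (θ * -Complex.I)) * Complex.exp (j * (θ * Complex.I)) := by
        rw [← Complex.exp_add]
        congr 1
        push_cast
        ring
      rw [this]
      push_cast
      ring
    · rw [indicator_of_notMem (by rw [mem_ball_zero_iff, hnorm]; exact h1),
        indicator_of_notMem (by simpa using h1)]
      simp
  rw [setIntegral_congr_fun (measurableSet_Ioi.prod measurableSet_Ioo) h,
    setIntegral_prod_mul (fun r : ℝ => (((Iio 1).indicator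
      (fun r : ℝ => r * (1 - r ^ 2) ^ b * r ^ (n + j)) r : ℝ) : ℂ))
      (fun θ : ℝ => Complex.exp (((j : ℝ) - n : ℝ) * θ * Complex.I)), integral_Ioo_exp]
  split_ifs with hj
  · subst hj
    rw [integral_complex_ofReal, setIntegral_indicator measurableSet_Iio,
      show Ioi (0 : ℝ) ∩ Iio 1 = Ioo 0 1 from rfl, ← integral_Ioc_eq_integral_Ioo,
      ← intervalIntegral.integral_of_le zero_le_one, ← integral_pow_mul_one_sub_sq_pow]
    have : ∀ t : ℝ, 2 * t * (1 - t ^ 2) ^ b * t ^ (2 * j) =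
        2 * (t * (1 - t ^ 2) ^ b * t ^ (j + j)) := fun t => by ring
    simp only [this, intervalIntegral.integral_const_mul]
    push_cast
    ring
  · rw [Complex.ofReal_zero, mul_zero]

/-- The squared norm `(b+2)_n / n!` of the coefficient in `basisFun`, for `2 η = b + 2`. -/
noncomputable def basisCoeffSq (b n : ℕ) : ℝ :=
  (b + 1 + n).factorial / ((b + 1).factorial * n.factorial)

theorem basisCoeffSq_pos (b n : ℕ) : 0 < basisCoeffSq b n := by
  unfold basisCoeffSq
  have := Nat.factorial_pos (b + 1 + n)
  have := Nat.factorial_pos (b + 1)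
  have := Nat.factorial_pos n
  positivity

theorem basisFun_eq {η : ℝ} {b : ℕ} (hη : 2 * η = b + 2) (n : ℕ) (z : ℂ) :
    basisFun η n z = (√(basisCoeffSq b n) : ℝ) * z ^ n := by
  have h1 : Real.Gamma (2 * η + n) = (b + 1 + n).factorial := by
    rw [← Real.Gamma_nat_eq_factorial, hη]
    push_cast
    congr 1
    ring
  have h2 : Real.Gamma (2 * η) = (b + 1).factorial := by
    rw [← Real.Gamma_nat_eq_factorial, hη]
    push_cast
    congr 1
    ring
  rw [basisFun, h1, h2, div_div, basisCoeffSq]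

/-- Monomials are orthogonal for a rotation-invariant weight, so the scalar product reads off one
Taylor coefficient. Absolute summability at radius 1 justifies integrating term by term, since each
weighted monomial is bounded by 1. -/
theorem fbInner_basisFun {η : ℝ} {b : ℕ} (hη : 2 * η = b + 2) (n : ℕ) {h : ℂ → ℂ} {a : ℕ → ℂ}
    (ha : Summable fun j => ‖a j‖) (hh : ∀ z, ‖z‖ < 1 → HasSum (fun j => a j * z ^ j) (h z)) :
    fbInner η (basisFun η n) h = a n / (√(basisCoeffSq b n) : ℝ) := by
  set w : ℕ → ℂ → ℂ := fun j z => conj (z ^ n) * z ^ j * (((1 - ‖z‖ ^ 2) ^ b : ℝ) : ℂ) with hw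
  have hint : ∀ j, IntegrableOn (w j) (Metric.ball 0 1) := fun j =>
    ((show Continuous (w j) by fun_prop).continuousOn.integrableOn_compact
      (isCompact_closedBall (0 : ℂ) 1)).mono_set Metric.ball_subset_closedBall
  have hbound : ∀ (j : ℕ) (z : ℂ), z ∈ Metric.ball (0 : ℂ) 1 → ‖w j z‖ ≤ 1 := by
    intro j z hz
    have hz : ‖z‖ < 1 := by simpa using hz
    have h0 := norm_nonneg z
    have h1 : 0 ≤ 1 - ‖z‖ ^ 2 := by nlinarith
    rw [hw]
    simp only [norm_mul, RCLike.norm_conj, norm_pow, Complex.norm_real,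
      Real.norm_of_nonneg (pow_nonneg h1 b)]
    exact mul_le_one₀ (mul_le_one₀ (pow_le_one₀ h0 hz.le) (by positivity) (pow_le_one₀ h0 hz.le))
      (by positivity) (pow_le_one₀ h1 (by nlinarith))
  have hsum : Summable fun j => ∫ z in Metric.ball (0 : ℂ) 1, ‖a j * w j z‖ := by
    refine Summable.of_nonneg_of_le (fun j => integral_nonneg fun z => norm_nonneg _) (fun j => ?_)
      (ha.mul_right (1 * volume.real (Metric.ball (0 : ℂ) 1)))
    simp only [norm_mul (a j), integral_const_mul]
    refine mul_le_mul_of_nonneg_left ((le_abs_self _).trans ?_) (norm_nonneg _)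
    exact norm_setIntegral_le_of_norm_le_const (f := fun z => ‖w j z‖) measure_ball_lt_top
      fun z hz => (norm_norm _).trans_le (hbound j z hz)
  have hseries := hasSum_integral_of_summable_integral_norm
    (fun j => (hint j).const_mul (a j)) hsum
  have hsingle : HasSum (fun j => ∫ z in Metric.ball (0 : ℂ) 1, a j * w j z)
      (a n * (π * (n.factorial * b.factorial / (n + b + 1).factorial) : ℝ)) := by
    simp only [integral_const_mul, hw, integral_ball_monomial]
    convert! hasSum_ite_eq n
      (a n * ((π * (n.factorial * b.factorial / (n + b + 1).factorial) : ℝ) : ℂ)) using 2 with j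
    split_ifs with hj
    · rw [hj]
    · rw [Complex.ofReal_zero, mul_zero]
  have hval := hseries.unique hsingle
  have hcongr : ∫ z in Metric.ball (0 : ℂ) 1, conj (basisFun η n z) * h z *
      (((1 - ‖z‖ ^ 2) ^ (2 * η - 2) : ℝ) : ℂ) =
        (√(basisCoeffSq b n) : ℝ) * ∫ z in Metric.ball (0 : ℂ) 1, ∑' j, a j * w j z := by
    rw [← integral_const_mul]
    refine setIntegral_congr_fun measurableSet_ball fun z hz => ?_
    have hz : ‖z‖ < 1 := by simpa using hz
    have h1 := (((hh z hz).mul_left (conj (z ^ n))).mul_right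
      (((1 - ‖z‖ ^ 2) ^ b : ℝ) : ℂ)).tsum_eq
    have h2 : ∀ j, a j * w j z =
        conj (z ^ n) * (a j * z ^ j) * (((1 - ‖z‖ ^ 2) ^ b : ℝ) : ℂ) := fun j => by
      rw [hw]; ring
    simp only [h2, h1]
    rw [basisFun_eq hη, hη, add_sub_cancel_right, Real.rpow_natCast, map_mul,
      Complex.conj_ofReal]
    ring
  rw [fbInner, hcongr, hval, hη]
  have hpos := basisCoeffSq_pos b n
  have hs : ((√(basisCoeffSq b n) : ℝ) : ℂ) ≠ 0 := by exact_mod_cast (Real.sqrt_pos.2 hpos).ne'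
  rw [eq_div_iff hs]
  have hsq : ((√(basisCoeffSq b n) : ℝ) : ℂ) * (√(basisCoeffSq b n) : ℝ) =
      (basisCoeffSq b n : ℝ) := by
    rw [← Complex.ofReal_mul, Real.mul_self_sqrt hpos.le]
  -- This says that the basis function has norm 1.
  have hone : (((b : ℝ) + 2 - 1) / π) * basisCoeffSq b n *
      (π * (n.factorial * b.factorial / (n + b + 1).factorial)) = 1 := by
    rw [basisCoeffSq, show b + 1 + n = n + b + 1 by ring, Nat.factorial_succ b]
    have := Nat.factorial_ne_zero (n + b + 1)
    have := Nat.factorial_ne_zero n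
    have := Nat.factorial_ne_zero b
    have := Real.pi_ne_zero
    push_cast
    field_simp
    ring
  have hone' := congrArg (fun x : ℝ => (x : ℂ)) hone
  simp only [Complex.ofReal_mul, Complex.ofReal_one] at hone'
  simp only [Complex.ofReal_mul]
  linear_combination (a n * ((((b : ℝ) + 2 - 1) / π : ℝ) : ℂ) * ((π : ℝ) : ℂ) *
    ((n.factorial * b.factorial / (n + b + 1).factorial : ℝ) : ℂ)) * hsq + a n * hone'

theorem hasSum_mul_powerSeries {f g : PowerSeries ℂ} {u v w : ℂ}
    (hf : Summable fun n => ‖PowerSeries.coeff n f * u ^ n‖)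
    (hf' : ∑' n, PowerSeries.coeff n f * u ^ n = v)
    (hg : Summable fun n => ‖PowerSeries.coeff n g * u ^ n‖)
    (hg' : ∑' n, PowerSeries.coeff n g * u ^ n = w) :
    (Summable fun n => ‖PowerSeries.coeff n (f * g) * u ^ n‖) ∧
      ∑' n, PowerSeries.coeff n (f * g) * u ^ n = v * w := by
  have h : ∀ n, PowerSeries.coeff n (f * g) * u ^ n = ∑ p ∈ Finset.HasAntidiagonal.antidiagonal n,
      (PowerSeries.coeff p.1 f * u ^ p.1) * (PowerSeries.coeff p.2 g * u ^ p.2) := by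
    intro n
    rw [PowerSeries.coeff_mul, Finset.sum_mul]
    refine Finset.sum_congr rfl fun p hp => ?_
    rw [← Finset.HasAntidiagonal.mem_antidiagonal.1 hp, pow_add]
    ring
  simp only [h]
  refine ⟨summable_norm_sum_mul_antidiagonal_of_summable_norm
    (f := fun n => PowerSeries.coeff n f * u ^ n) (g := fun n => PowerSeries.coeff n g * u ^ n)
    hf hg, ?_⟩
  rw [← tsum_mul_tsum_eq_tsum_sum_antidiagonal_of_summable_norm hf hg, hf', hg']

theorem hasSum_pow_powerSeries {f : PowerSeries ℂ} {u v : ℂ}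
    (hf : Summable fun n => ‖PowerSeries.coeff n f * u ^ n‖)
    (hf' : ∑' n, PowerSeries.coeff n f * u ^ n = v) (l : ℕ) :
    (Summable fun n => ‖PowerSeries.coeff n (f ^ l) * u ^ n‖) ∧
      ∑' n, PowerSeries.coeff n (f ^ l) * u ^ n = v ^ l := by
  induction l with
  | zero =>
    have h : ∀ n, PowerSeries.coeff n (f ^ 0) * u ^ n = if n = 0 then 1 else 0 := by
      intro n
      rw [pow_zero, PowerSeries.coeff_one]
      split_ifs with h <;> simp [h]
    simp only [h]
    refine ⟨summable_of_ne_finset_zero (s := {0}) fun n hn => ?_, by simp⟩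
    rw [if_neg (by simpa using hn), norm_zero]
  | succ l ih =>
    rw [pow_succ, pow_succ]
    exact hasSum_mul_powerSeries ih.1 ih.2 hf hf'

/-- The only possible singularity is at `1/t`, outside the closed disk, so the expansion converges
absolutely up to `|u| = 1`. The formal product is evaluated by Cauchy products. -/
theorem hasSum_radialPoly (k l : ℕ) {t : ℝ} (ht : |t| < 1) {u : ℂ} (hu : ‖u‖ ≤ 1) :
    (Summable fun n => ‖(((radialPoly k l n).eval t : ℝ) : ℂ) * u ^ n‖) ∧
      ∑' n, (((radialPoly k l n).eval t : ℝ) : ℂ) * u ^ n =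
        (u - t) ^ l * ((1 - t * u)⁻¹) ^ (k + l) := by
  set ev : Polynomial ℝ →+* ℂ := (algebraMap ℝ ℂ).comp (Polynomial.evalRingHom t) with hev
  have hcoeff : ∀ n, (((radialPoly k l n).eval t : ℝ) : ℂ) =
      PowerSeries.coeff n ((PowerSeries.X - PowerSeries.C (t : ℂ)) ^ l *
        (PowerSeries.mk fun n => (t : ℂ) ^ n) ^ (k + l)) := by
    intro n
    have h1 : PowerSeries.map ev geomSeries = PowerSeries.mk fun n => (t : ℂ) ^ n := by
      ext n
      simp [geomSeries, hev]
    have h2 : PowerSeries.map ev (radialSeries k l) =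
        (PowerSeries.X - PowerSeries.C (t : ℂ)) ^ l *
          (PowerSeries.mk fun n => (t : ℂ) ^ n) ^ (k + l) := by
      rw [radialSeries, map_mul, map_pow, map_pow, h1, map_sub, PowerSeries.map_X,
        PowerSeries.map_C]
      simp [hev]
    rw [← h2, PowerSeries.coeff_map]
    rfl
  simp only [hcoeff]
  have hlt : ‖(t : ℂ) * u‖ < 1 := by
    rw [norm_mul, Complex.norm_real, Real.norm_eq_abs]
    nlinarith [abs_nonneg t, norm_nonneg u]
  have hlin : ∀ n, PowerSeries.coeff n (PowerSeries.X - PowerSeries.C (t : ℂ)) * u ^ n =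
      (if n = 1 then u else 0) - (if n = 0 then (t : ℂ) else 0) := by
    intro n
    rw [map_sub, PowerSeries.coeff_X, PowerSeries.coeff_C]
    rcases n with _ | _ | n <;> simp
  have hX := hasSum_pow_powerSeries (f := PowerSeries.X - PowerSeries.C (t : ℂ)) (u := u)
    (v := u - t) (by
      simp only [hlin]
      refine summable_of_ne_finset_zero (s := {0, 1}) fun n hn => ?_
      simp only [Finset.mem_insert, Finset.mem_singleton, not_or] at hn
      simp [hn.1, hn.2]) (by
      simp only [hlin]
      exact ((hasSum_ite_eq 1 u).sub (hasSum_ite_eq 0 (t : ℂ))).tsum_eq) l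
  have hG := hasSum_pow_powerSeries (f := PowerSeries.mk fun n => (t : ℂ) ^ n) (u := u)
    (v := (1 - t * u)⁻¹) (by
      simp only [PowerSeries.coeff_mk, ← mul_pow, norm_pow]
      exact summable_geometric_of_lt_one (norm_nonneg _) hlt) (by
      simp only [PowerSeries.coeff_mk, ← mul_pow]
      exact tsum_geometric_of_norm_lt_one hlt) (k + l)
  exact hasSum_mul_powerSeries hX.1 hX.2 hG.1 hG.2

/-- With `v = exp (-iφ)`, the denominator of the Möbius map is `C E₁ (1 - t v z)` and the numerator
is `C E₂ (v z - t)`. The transformed basis function is thus a constant times the generating function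
of the radial polynomials at `v z`. -/
theorem matrixElement_param {η : ℝ} {b : ℕ} (hη : 2 * η = b + 2) (n l : ℕ) (τ φ ψ : ℝ) :
    matrixElement η n l (param (τ, φ, ψ)) =
      ((√(basisCoeffSq b l) / √(basisCoeffSq b n) / Real.cosh (τ / 2) ^ (b + 2) *
        (radialPoly (b + 2) l n).eval (Real.tanh (τ / 2)) : ℝ) : ℂ) *
      Complex.exp ((-(η + n) : ℝ) * φ * Complex.I) *
      Complex.exp ((-(η + l) : ℝ) * ψ * Complex.I) := by
  set C : ℝ := Real.cosh (τ / 2) with hC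
  set t : ℝ := Real.tanh (τ / 2) with ht
  have hCpos : 0 < C := Real.cosh_pos _
  have hC0 : (C : ℂ) ≠ 0 := by exact_mod_cast hCpos.ne'
  have hS : Real.sinh (τ / 2) = C * t := by
    rw [ht, Real.tanh_eq_sinh_div_cosh, hC, mul_div_cancel₀ _ hCpos.ne']
  have htlt : |t| < 1 := Real.abs_tanh_lt_one _
  set E₁ : ℂ := Complex.exp (((φ + ψ) / 2 : ℝ) * Complex.I) with hE₁
  set E₂ : ℂ := Complex.exp (((φ - ψ) / 2 : ℝ) * Complex.I) with hE₂
  set v : ℂ := Complex.exp ((-φ : ℝ) * Complex.I) with hv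
  have hE₁0 : E₁ ≠ 0 := Complex.exp_ne_zero _
  have hvnorm : ‖v‖ = 1 := Complex.norm_exp_ofReal_mul_I _
  have hα : alpha (param (τ, φ, ψ)) = C * E₁ := alpha_param τ φ ψ
  have hβ : beta (param (τ, φ, ψ)) = C * t * E₂ := by
    rw [beta_param, hS, Complex.ofReal_mul]
  have hα' : conj (alpha (param (τ, φ, ψ))) = C * (E₂ * v) := by
    rw [hα, map_mul, Complex.conj_ofReal, hE₁, ← Complex.exp_conj, hE₂, hv, ← Complex.exp_add]
    congr 2
    simp only [map_mul, Complex.conj_ofReal, Complex.conj_I]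
    push_cast
    ring
  have hβ' : conj (beta (param (τ, φ, ψ))) = C * t * (E₁ * v) := by
    rw [hβ, map_mul, map_mul, Complex.conj_ofReal, Complex.conj_ofReal, hE₂, ← Complex.exp_conj,
      hE₁, hv, ← Complex.exp_add]
    congr 2
    simp only [map_mul, Complex.conj_ofReal, Complex.conj_I]
    push_cast
    ring
  set P : ℂ := (√(basisCoeffSq b l) : ℝ) * (((C : ℂ) * E₁) ^ (b + 2))⁻¹ * (E₂ / E₁) ^ l with hP
  have key := fbInner_basisFun hη n (h := discreteSeries η (param (τ, φ, ψ)) (basisFun η l))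
    (a := fun j => P * ((((radialPoly (b + 2) l j).eval t : ℝ) : ℂ) * v ^ j)) ?_ ?_
  · rw [matrixElement, key]
    have hexp : (E₁ ^ (b + 2))⁻¹ * (E₂ / E₁) ^ l * v ^ n =
        Complex.exp ((-(η + n) : ℝ) * φ * Complex.I) *
          Complex.exp ((-(η + l) : ℝ) * ψ * Complex.I) := by
      have hη' : (η : ℂ) = (b + 2) / 2 := by
        have : η = (b + 2) / 2 := by linarith
        rw [this]
        push_cast
        rfl
      rw [hE₁, hE₂, hv, ← Complex.exp_sub, ← Complex.exp_nat_mul, ← Complex.exp_nat_mul,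
        ← Complex.exp_nat_mul, ← Complex.exp_neg, ← Complex.exp_add, ← Complex.exp_add,
        ← Complex.exp_add]
      congr 1
      push_cast
      rw [hη']
      ring
    rw [mul_assoc _ (Complex.exp _), ← hexp, hP, mul_pow, mul_inv]
    push_cast
    ring
  -- Summability of the Taylor coefficients themselves is the boundary case `|u| = 1`, taken at `u =
  -- v`.
  · have h := ((hasSum_radialPoly (b + 2) l htlt hvnorm.le).1).mul_left ‖P‖
    simpa only [norm_mul] using h
  · intro z hz
    have hu : ‖v * z‖ < 1 := by rwa [norm_mul, hvnorm, one_mul]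
    obtain ⟨h₁, h₂⟩ := hasSum_radialPoly (b + 2) l htlt hu.le
    have h := (h₁.of_norm.hasSum).mul_left P
    rw [h₂] at h
    have hlt : ‖(t : ℂ) * (v * z)‖ < 1 := by
      rw [norm_mul, Complex.norm_real, Real.norm_eq_abs]
      nlinarith [abs_nonneg t, norm_nonneg (v * z)]
    have hne : 1 - (t : ℂ) * (v * z) ≠ 0 := by
      intro h0
      rw [← sub_eq_zero.1 h0, norm_one] at hlt
      exact lt_irrefl _ hlt
    have hden : -(C * t * (E₁ * v)) * z + C * E₁ = C * E₁ * (1 - t * (v * z)) := by ring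
    have hnum : C * (E₂ * v) * z - C * t * E₂ = C * E₂ * (v * z - t) := by ring
    have hpow : (2 * (η : ℂ)) = ((b + 2 : ℕ) : ℂ) := by
      have := congrArg (fun x : ℝ => (x : ℂ)) hη
      push_cast at this ⊢
      exact this
    convert! h using 1
    · ext j
      ring
    · rw [discreteSeries, basisFun_eq hη, hα', hβ', hα, hβ, hden, hnum, hpow, Complex.cpow_neg,
        Complex.cpow_natCast, hP, mul_assoc (C : ℂ) E₂, mul_assoc (C : ℂ) E₁,
        mul_div_mul_left _ _ hC0, mul_div_mul_comm, mul_pow (E₂ / E₁), div_pow (v * z - t),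
        ← mul_assoc (C : ℂ) E₁, mul_pow (C * E₁), mul_inv, pow_add (1 - (t : ℂ) * (v * z))⁻¹,
        inv_pow, inv_pow]
      ring

end MatrixElement

end SU11

namespace SU11

/-! ### Angular and radial integration. -/

section Orthogonality

open MeasureTheory Set
open scoped Real

/-- Integration against a push-forward asks for measurability on the group itself, not only in
coordinates; it follows from joint measurability of the integrand in `(g, z)`. -/
theorem measurable_matrixElement (η : ℝ) (n l : ℕ) : Measurable (matrixElement η n l) := by
  have hα : Measurable fun p : SU11 × ℂ => alpha p.1 :=
    continuous_alpha.measurable.comp measurable_fst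
  have hβ : Measurable fun p : SU11 × ℂ => beta p.1 :=
    continuous_beta.measurable.comp measurable_fst
  have hconj : Measurable (conj : ℂ → ℂ) := Complex.continuous_conj.measurable
  have hbasis : ∀ j, Measurable (basisFun η j) := fun j => by
    unfold basisFun
    fun_prop
  have hden : Measurable fun p : SU11 × ℂ => -conj (beta p.1) * p.2 + alpha p.1 :=
    ((hconj.comp hβ).neg.mul measurable_snd).add hα
  have hnum : Measurable fun p : SU11 × ℂ => conj (alpha p.1) * p.2 - beta p.1 :=
    ((hconj.comp hα).mul measurable_snd).sub hβ
  have hds : Measurable fun p : SU11 × ℂ => discreteSeries η p.1 (basisFun η l) p.2 :=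
    (hden.pow_const _).mul ((hbasis l).comp (hnum.div hden))
  have hint : Measurable fun p : SU11 × ℂ => conj (basisFun η n p.2) *
      discreteSeries η p.1 (basisFun η l) p.2 * (((1 - ‖p.2‖ ^ 2) ^ (2 * η - 2) : ℝ) : ℂ) := by
    refine ((hconj.comp ((hbasis n).comp measurable_snd)).mul hds).mul
      (Complex.measurable_ofReal.comp ?_)
    fun_prop
  exact (hint.stronglyMeasurable.integral_prod_right'
    (ν := volume.restrict (Metric.ball (0 : ℂ) 1))).measurable.const_mul _

/-- The substitution `t = tanh (τ/2)`. Here `N` stands for `2η₁ + 2η₂ - 4`, which may be odd, hence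
the square root: integrability is needed for either parity. -/
theorem sinh_div_cosh_pow_eq (p q : Polynomial ℝ) (N : ℕ) {τ : ℝ} (hτ : 0 < τ) :
    Real.sinh τ / Real.cosh (τ / 2) ^ (N + 4) *
      (p.eval (Real.tanh (τ / 2)) * q.eval (Real.tanh (τ / 2))) =
    |1 / (2 * Real.cosh (τ / 2) ^ 2)| • (2 * (2 * Real.tanh (τ / 2) *
      √(1 - Real.tanh (τ / 2) ^ 2) ^ N * p.eval (Real.tanh (τ / 2)) *
        q.eval (Real.tanh (τ / 2)))) := by
  have hc := Real.cosh_pos (τ / 2)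
  have h1 : 1 - Real.tanh (τ / 2) ^ 2 = (1 / Real.cosh (τ / 2)) ^ 2 := by
    have := Real.cosh_sq_sub_sinh_sq (τ / 2)
    rw [Real.tanh_eq_sinh_div_cosh]
    field_simp
    exact this
  have h2 : Real.sinh τ = 2 * Real.sinh (τ / 2) * Real.cosh (τ / 2) := by
    rw [← Real.sinh_two_mul, mul_div_cancel₀ _ two_ne_zero]
  rw [h1, Real.sqrt_sq (by positivity), abs_of_pos (by positivity), h2, smul_eq_mul]
  generalize p.eval (Real.tanh (τ / 2)) = x
  generalize q.eval (Real.tanh (τ / 2)) = y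
  rw [Real.tanh_eq_sinh_div_cosh, pow_add, one_div_pow]
  field_simp

theorem injOn_tanh_half : InjOn (fun τ : ℝ => Real.tanh (τ / 2)) (Ioi 0) := by
  simpa using (injective_mul_tanh_half one_pos).injOn

theorem image_tanh_half : (fun τ : ℝ => Real.tanh (τ / 2)) '' Ioi 0 = Ioo 0 1 := by
  simpa using image_mul_tanh_half one_pos

theorem integrableOn_radial (p q : Polynomial ℝ) (N : ℕ) :
    IntegrableOn (fun τ => Real.sinh τ / Real.cosh (τ / 2) ^ (N + 4) *
      (p.eval (Real.tanh (τ / 2)) * q.eval (Real.tanh (τ / 2)))) (Ioi 0) := by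
  have h := (integrableOn_image_iff_integrableOn_abs_deriv_smul measurableSet_Ioi
    (fun τ _ => (hasDerivAt_tanh_half τ).hasDerivWithinAt) injOn_tanh_half
    (fun t => 2 * (2 * t * √(1 - t ^ 2) ^ N * p.eval t * q.eval t))).1 (by
      rw [image_tanh_half]
      exact ((show Continuous fun t : ℝ =>
        2 * (2 * t * √(1 - t ^ 2) ^ N * p.eval t * q.eval t) by fun_prop).continuousOn
          |>.integrableOn_compact isCompact_Icc).mono_set Ioo_subset_Icc_self)
  exact h.congr_fun (fun τ hτ => (sinh_div_cosh_pow_eq p q N hτ).symm) measurableSet_Ioi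

theorem integral_radial (p q : Polynomial ℝ) (b : ℕ) :
    ∫ τ in Ioi 0, Real.sinh τ / Real.cosh (τ / 2) ^ (2 * b + 4) *
      (p.eval (Real.tanh (τ / 2)) * q.eval (Real.tanh (τ / 2))) = 2 * radialPairing b p q := by
  rw [setIntegral_congr_fun measurableSet_Ioi
    (fun τ hτ => sinh_div_cosh_pow_eq p q (2 * b) hτ)]
  have h := integral_image_eq_integral_abs_deriv_smul (measurableSet_Ioi (a := (0 : ℝ)))
      (fun τ _ => (hasDerivAt_tanh_half τ).hasDerivWithinAt) injOn_tanh_half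
      (fun t => 2 * (2 * t * √(1 - t ^ 2) ^ (2 * b) * p.eval t * q.eval t))
  rw [← h, image_tanh_half, integral_const_mul, radialPairing, ← integral_Ioc_eq_integral_Ioo,
    intervalIntegral.integral_of_le zero_le_one]
  congr 1
  refine setIntegral_congr_fun measurableSet_Ioc fun t ht => ?_
  have h1 : 0 ≤ 1 - t ^ 2 := by nlinarith [ht.1, ht.2]
  simp only [pow_mul, Real.sq_sqrt h1]
  simp

theorem integral_haar_param (f : SU11 → ℂ) (hf : Measurable f) {R : ℝ → ℝ} {A B : ℝ}
    (hfR : ∀ τ φ ψ, f (param (τ, φ, ψ)) =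
      (R τ : ℂ) * Complex.exp (A * φ * Complex.I) * Complex.exp (B * ψ * Complex.I))
    (hR : IntegrableOn (fun τ => Real.sinh τ * R τ) (Ioi 0)) :
    Integrable f haar ∧ ∫ g, f g ∂haar =
      ((1 / (8 * π ^ 2) * ∫ τ in Ioi 0, Real.sinh τ * R τ : ℝ) : ℂ) *
        ((∫ φ in (0)..(2 * π), Complex.exp (A * φ * Complex.I)) *
          ∫ ψ in (-(2 * π))..(2 * π), Complex.exp (B * ψ * Complex.I)) := by
  have hp := continuous_param.measurable
  have hd : Measurable fun p : ℝ × ℝ × ℝ =>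
      ENNReal.ofReal (1 / (8 * π ^ 2) * Real.sinh p.1) := by fun_prop
  set d : ℝ → ℝ := fun τ => (ENNReal.ofReal (1 / (8 * π ^ 2) * Real.sinh τ)).toReal * R τ with hdd
  have hfun : ∀ p : ℝ × ℝ × ℝ,
      (ENNReal.ofReal (1 / (8 * π ^ 2) * Real.sinh p.1)).toReal • f (param p) =
        (d p.1 : ℂ) * (Complex.exp (A * p.2.1 * Complex.I) *
          Complex.exp (B * p.2.2 * Complex.I)) := by
    rintro ⟨τ, φ, ψ⟩
    simp only [hfR, hdd, Complex.real_smul]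
    push_cast
    ring
  have hcongr : ∀ τ ∈ Ioi (0 : ℝ), d τ = 1 / (8 * π ^ 2) * (Real.sinh τ * R τ) := by
    intro τ hτ
    have : 0 < Real.sinh τ := Real.sinh_pos_iff.2 hτ
    rw [hdd]
    simp only
    rw [ENNReal.toReal_ofReal (by positivity), mul_assoc]
  have hdint : IntegrableOn (fun τ => (d τ : ℂ)) (Ici 0) := by
    rw [integrableOn_Ici_iff_integrableOn_Ioi]
    refine Integrable.ofReal ?_
    exact (integrableOn_congr_fun hcongr measurableSet_Ioi).2 (hR.const_mul _)
  have hexp : ∀ (D a b : ℝ), IntegrableOn (fun x : ℝ => Complex.exp (D * x * Complex.I))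
      (Ico a b) := fun D a b =>
    ((show Continuous fun x : ℝ => Complex.exp (D * x * Complex.I) by fun_prop).continuousOn
      |>.integrableOn_compact isCompact_Icc).mono_set Ico_subset_Icc_self
  have hexpint : ∀ {D a b : ℝ}, a ≤ b → ∫ x in Ico a b, Complex.exp (D * x * Complex.I) =
      ∫ x in a..b, Complex.exp (D * x * Complex.I) := fun hab => by
    rw [intervalIntegral.integral_of_le hab, integral_Ico_eq_integral_Ioo,
      integral_Ioc_eq_integral_Ioo]
  have htop : ∀ᵐ p ∂((volume : Measure (ℝ × ℝ × ℝ)).restrict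
      (Ici 0 ×ˢ Ico 0 (2 * π) ×ˢ Ico (-(2 * π)) (2 * π))),
        ENNReal.ofReal (1 / (8 * π ^ 2) * Real.sinh p.1) < ⊤ :=
    Filter.Eventually.of_forall fun _ => ENNReal.ofReal_lt_top
  constructor
  · rw [haar, integrable_map_measure hf.aestronglyMeasurable hp.aemeasurable,
      integrable_withDensity_iff_integrable_smul' hd htop]
    simp only [Function.comp, hfun]
    rw [Measure.volume_eq_prod, ← Measure.prod_restrict, Measure.volume_eq_prod,
      ← Measure.prod_restrict]
    exact Integrable.mul_prod (f := fun τ : ℝ => (d τ : ℂ)) (g := fun p : ℝ × ℝ =>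
      Complex.exp (A * p.1 * Complex.I) * Complex.exp (B * p.2 * Complex.I)) hdint
      (Integrable.mul_prod (f := fun φ : ℝ => Complex.exp (A * φ * Complex.I))
        (g := fun ψ : ℝ => Complex.exp (B * ψ * Complex.I)) (hexp A _ _) (hexp B _ _))
  · rw [haar, integral_map hp.aemeasurable hf.aestronglyMeasurable,
      integral_withDensity_eq_integral_toReal_smul hd htop]
    simp only [hfun]
    rw [Measure.volume_eq_prod, setIntegral_prod_mul (fun τ : ℝ => (d τ : ℂ))
      (fun p : ℝ × ℝ => Complex.exp (A * p.1 * Complex.I) * Complex.exp (B * p.2 * Complex.I)),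
      Measure.volume_eq_prod, setIntegral_prod_mul
      (fun φ : ℝ => Complex.exp (A * φ * Complex.I)) (fun ψ : ℝ => Complex.exp (B * ψ * Complex.I)),
      hexpint (by positivity), hexpint (by linarith [Real.pi_pos])]
    congr 1
    rw [integral_Ici_eq_integral_Ioi, integral_complex_ofReal,
      setIntegral_congr_fun measurableSet_Ioi hcongr, integral_const_mul]

theorem orthogonality {η₁ η₂ : ℝ} {b₁ b₂ : ℕ} (hη₁ : 2 * η₁ = b₁ + 2) (hη₂ : 2 * η₂ = b₂ + 2)
    (m m' n n' : ℕ) :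
    Integrable (fun g : SU11 => matrixElement η₁ m m' g * conj (matrixElement η₂ n n' g)) haar ∧
    ∫ g : SU11, matrixElement η₁ m m' g * conj (matrixElement η₂ n n' g) ∂haar =
      (formalDim η₁ : ℂ) * (if η₁ = η₂ then 1 else 0) * (if m = n then 1 else 0) *
        (if m' = n' then 1 else 0) := by
  set K : ℝ := √(basisCoeffSq b₁ m') / √(basisCoeffSq b₁ m) *
    (√(basisCoeffSq b₂ n') / √(basisCoeffSq b₂ n)) with hK
  set p := radialPoly (b₁ + 2) m' m with hp
  set q := radialPoly (b₂ + 2) n' n with hq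
  have hR : ∀ τ, Real.sinh τ * (K / Real.cosh (τ / 2) ^ (b₁ + b₂ + 4) *
      (p.eval (Real.tanh (τ / 2)) * q.eval (Real.tanh (τ / 2)))) =
      K * (Real.sinh τ / Real.cosh (τ / 2) ^ (b₁ + b₂ + 4) *
        (p.eval (Real.tanh (τ / 2)) * q.eval (Real.tanh (τ / 2)))) := fun τ => by ring
  obtain ⟨hi, hv⟩ := integral_haar_param
    (fun g : SU11 => matrixElement η₁ m m' g * conj (matrixElement η₂ n n' g))
    ((measurable_matrixElement _ _ _).mul
      (Complex.continuous_conj.measurable.comp (measurable_matrixElement _ _ _)))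
    (R := fun τ => K / Real.cosh (τ / 2) ^ (b₁ + b₂ + 4) *
      (p.eval (Real.tanh (τ / 2)) * q.eval (Real.tanh (τ / 2))))
    (A := η₂ + n - (η₁ + m)) (B := η₂ + n' - (η₁ + m'))
    (fun τ φ ψ => by
      rw [matrixElement_param hη₁, matrixElement_param hη₂, map_mul, map_mul, Complex.conj_ofReal,
        ← Complex.exp_conj, ← Complex.exp_conj]
      simp only [map_mul, Complex.conj_ofReal, Complex.conj_I]
      have e : ∀ x y z : ℝ, Complex.exp ((x - y : ℝ) * z * Complex.I) =
          Complex.exp ((-y : ℝ) * z * Complex.I) * Complex.exp ((-x : ℝ) * z * -Complex.I) := by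
        intro x y z
        rw [← Complex.exp_add]
        congr 1
        push_cast
        ring
      rw [e, e, pow_add, pow_add, pow_add, hp, hq, hK]
      push_cast
      ring)
    (by simp only [hR]; exact (integrableOn_radial p q (b₁ + b₂)).const_mul _)
  refine ⟨hi, ?_⟩
  rw [hv]
  simp only [hR]
  -- The order matters. The frequencies may be half-integers, and only the `ψ` interval, of length
  -- `4π`, is a full period for these. Once the `ψ` frequency is 0, the `φ` frequency is an integer
  -- and length `2π` suffices.
  by_cases hB : η₂ + n' - (η₁ + m') = 0
  swap
  · rw [intervalIntegral_exp_eq_zero hB, mul_zero, mul_zero]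
    · by_cases h1 : η₁ = η₂
      · have : m' ≠ n' := fun h2 => hB (by rw [h1, h2]; ring)
        simp [this]
      · simp [h1]
    · rw [Complex.exp_eq_exp_iff_exists_int]
      refine ⟨(b₂ : ℤ) + 2 * n' - b₁ - 2 * m', ?_⟩
      have e : η₂ + n' - (η₁ + m') = ((b₂ : ℝ) + 2 * n' - b₁ - 2 * m') / 2 := by linarith
      rw [e]
      push_cast
      ring
  by_cases hA : η₂ + n - (η₁ + m) = 0
  swap
  · rw [intervalIntegral_exp_eq_zero hA, zero_mul, mul_zero]
    · by_cases h1 : η₁ = η₂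
      · have : m ≠ n := fun h2 => hA (by rw [h1, h2]; ring)
        simp [this]
      · simp [h1]
    · rw [Complex.exp_eq_exp_iff_exists_int]
      refine ⟨(n : ℤ) - n' + m' - m, ?_⟩
      have e : η₂ + n - (η₁ + m) = (n : ℝ) - n' + m' - m := by linarith
      rw [e]
      push_cast
      ring
  have hl : b₁ + 2 + 2 * m' = b₂ + 2 + 2 * n' := by
    have : (b₁ : ℝ) + 2 + 2 * m' = b₂ + 2 + 2 * n' := by linarith
    exact_mod_cast this
  have hn : b₁ + 2 + 2 * m = b₂ + 2 + 2 * n := by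
    have : (b₁ : ℝ) + 2 + 2 * m = b₂ + 2 + 2 * n := by linarith
    exact_mod_cast this
  -- Equal weights force `b₁` and `b₂` to have the same parity, so the square root disappears from
  -- the radial weight.
  obtain ⟨b, hb⟩ : ∃ b, b₁ + b₂ = 2 * b := ⟨b₁ + m' - n', by omega⟩
  rw [hb, integral_const_mul, integral_radial]
  have hη : η₁ = η₂ ↔ b₁ = b₂ := by
    constructor
    · intro h
      have : (b₁ : ℝ) = b₂ := by linarith
      exact_mod_cast this
    · rintro rfl
      linarith
  by_cases h1 : b₁ = b₂
  swap
  · rw [radialPairing_eq_zero (by omega) hl hn (by omega)]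
    simp [hη, h1]
  · subst h1
    obtain rfl : m = n := by omega
    obtain rfl : m' = n' := by omega
    obtain rfl : b = b₁ := by omega
    rw [hA, hB, radialPairing_self]
    simp only [if_pos (hη.2 rfl), if_true, mul_one, Complex.ofReal_zero, zero_mul,
      Complex.exp_zero, intervalIntegral.integral_const]
    have hdim : formalDim η₁ = 2 / (b + 1) := by
      rw [formalDim, hη₁]
      congr 1
      ring
    -- The angles contribute `2π · 4π`, cancelling `8π²`. The pairing is `basisCoeffSq b m / ((b +
    -- 1) * basisCoeffSq b m')`, and `K` is the inverse ratio of the coefficients, so `2/(b + 1)`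
    -- remains.
    have hval : 1 / (8 * π ^ 2) * (K * (2 * (((b + 1 + m).factorial /
        ((b + 1).factorial * m.factorial) : ℝ) *
          (m'.factorial * b.factorial / (m' + b + 1).factorial)))) * ((2 * π - 0) * (2 * π - -(2 * π)))
        = 2 / (b + 1) := by
      have h1 := Real.mul_self_sqrt (basisCoeffSq_pos b m').le
      have h2 := Real.mul_self_sqrt (basisCoeffSq_pos b m).le
      have hK' : K = basisCoeffSq b m' / basisCoeffSq b m := by
        rw [hK, div_mul_div_comm, h1, h2]
      rw [hK', basisCoeffSq, basisCoeffSq, show b + 1 + m' = m' + b + 1 by ring,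
        Nat.factorial_succ b]
      have := Nat.factorial_ne_zero (m' + b + 1)
      have := Nat.factorial_ne_zero (b + 1 + m)
      have := Nat.factorial_ne_zero m
      have := Nat.factorial_ne_zero m'
      have := Nat.factorial_ne_zero b
      have := Real.pi_ne_zero
      push_cast
      field_simp
      ring
    rw [hdim, ← hval]
    simp only [Complex.real_smul]
    push_cast
    ring

end Orthogonality

end SU11

theorem mainTheorem1 (η₁ η₂ : ℝ)
    (hη₁ : ∃ k : ℕ, 2 * η₁ = k) (hη₂ : ∃ k : ℕ, 2 * η₂ = k)
    (h₁ : 1 < 2 * η₁) (h₂ : 1 < 2 * η₂) (m m' n n' : ℕ) :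
    SU11.haar.IsHaarMeasure ∧
    MeasureTheory.Integrable
      (fun g : SU11 => SU11.matrixElement η₁ m m' g * conj (SU11.matrixElement η₂ n n' g))
      SU11.haar ∧
    ∫ g : SU11, SU11.matrixElement η₁ m m' g * conj (SU11.matrixElement η₂ n n' g) ∂SU11.haar =
      (SU11.formalDim η₁ : ℂ) * (if η₁ = η₂ then 1 else 0) * (if m = n then 1 else 0) *
        (if m' = n' then 1 else 0) := by
  have h : ∀ η : ℝ, (∃ k : ℕ, 2 * η = k) → 1 < 2 * η → ∃ b : ℕ, 2 * η = b + 2 := by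
    rintro η ⟨k, hk⟩ h1
    rw [hk] at h1
    have hk2 : 1 < k := by exact_mod_cast h1
    obtain ⟨b, rfl⟩ := Nat.exists_eq_add_of_lt hk2
    exact ⟨b, by rw [hk]; push_cast; ring⟩
  obtain ⟨b₁, hb₁⟩ := h η₁ hη₁ h₁
  obtain ⟨b₂, hb₂⟩ := h η₂ hη₂ h₂
  exact ⟨SU11.isHaarMeasure_haar, SU11.orthogonality hb₁ hb₂ m m' n n'⟩
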